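/- Let $(M,\mu)$ be a finite measure space, $H:=L^2(M;\mathbb C)$, and let $A$ be a non-negative self-adjoint operator on $H$. Let $E_A:=\mathcal D((\mathrm{Id}+A)^{1/2})$ with the norm $\|x\|_{E_A}=\|(\mathrm{Id}+A)^{1/2}x\|_H$, and let $E_A^*$ be the completion of $H$ with respect to the norm $\|(\mathrm{Id}+A)^{-1/2}x\|_H$, so that $E_A\hookrightarrow H\hookrightarrow E_A^*$. Let $\alpha>1$ be such that $E_A$ is compactly embedded in $L^{\alpha+1}(M)$, and let $T>0$. For a metric space $(S,d)$ let $\mathbb D([0,T],S)$ be the space of càdlàg functions $[0,T]\to S$ with the Skorokhod metric $$\rho(u,v)=\inf_{\lambda}\Big[\sup_{t}d(u(t),v(\lambda(t)))+\sup_t|t-\lambda(t)|+\sup_{s\ne t}\Big|\log\tfrac{\lambda(t)-\lambda(s)}{t-s}\Big|\Big],$$ where $\lambda$ ranges over the increasing homeomorphisms of $[0,T]$. Let $\mathbb D_w([0,T],E_A)$ be the space of functions $u:[0,T]\to E_A$ such that $\varphi\circ u$ is càdlàg for every continuous linear functional $\varphi$ on $E_A$, with the weakest topology for which all maps $u\mapsto\varphi\circ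 u\in\mathbb D([0,T],\mathbb C)$ are continuous. Put $$Z_T:=\mathbb D([0,T],E_A^*)\cap L^{\alpha+1}(0,T;L^{\alpha+1}(M))\cap\mathbb D_w([0,T],E_A),$$ with the smallest topology containing the traces of the topologies of the three spaces, and with its Borel $\sigma$-algebra. Let $(\Omega,\mathcal F,\mathbb P)$ be a probability space with a filtration $\mathbb F=(\mathcal F_t)_{t\in[0,T]}$ satisfying the usual conditions ($\mathbb P$ is complete, each $\mathcal F_t$ contains all null sets, and $\mathbb F$ is right-continuous). Let $(X_n)_{n\in\mathbb N}$ be a sequence of $\mathbb F$-adapted $E_A^*$-valued processes on $[0,T]$ with almost surely càdlàg paths, such that: (a) (Aldous condition in $E_A^*$) for all $\varepsilon,\eta>0$ there is $\delta>0$ such that for every sequence $(\tau_n)_{n\in\mathbb N}$ of $[0,T]$-valued $\mathbb F$-stopping times $$\sup_{n\in\mathbb N}\ \sup_{0<\theta\le\delta}\mathbb P\big\{\|X_n((\tau_n+\theta)\wedge T)-X_n(\tau_n)\|_{E_A^*}\ge\eta\big\}\le\varepsilon;$$ (b) $\displaystyle\sup_{n\in\mathbb N}\mathbb E\Big[\sup_{t\in[0,T]}\|X_n(t)\|_{E_A}^2\Big]<\infty$,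 where $\|x\|_{E_A}:=\infty$ for $x\in E_A^*\setminus E_A$. Then, for every $n$, almost all paths of $X_n$ belong to $Z_T$, $X_n$ defines (up to a null set) a $Z_T$-valued random variable, and the sequence of laws $(\mathbb P^{X_n})_{n\in\mathbb N}$ is tight on $Z_T$: for every $\varepsilon>0$ there is a compact set $K\subset Z_T$ with $\mathbb P^{X_n}(Z_T\setminus K)\le\varepsilon$ for all $n$. -/

import Mathlib

open Set Filter Topology MeasureTheory
open scoped ENNReal

noncomputable section

/-! ### Càdlàg functions and the Skorokhod metric -/

/-- `f` is right-continuous with left limits at every point. -/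
def IsCadlag {ι S : Type*} [Preorder ι] [TopologicalSpace ι] [TopologicalSpace S]
    (f : ι → S) : Prop :=
  ∀ t, ContinuousWithinAt f (Ici t) t ∧ ∃ l, Tendsto f (𝓝[<] t) (𝓝 l)

/-- The set `𝔻([0,T], S)` of càdlàg functions on `[0,T]`. -/
structure CadlagPath (T : ℝ) (S : Type*) [TopologicalSpace S] where
  toFun : Icc (0 : ℝ) T → S
  isCadlag : IsCadlag toFun

namespace Skorokhod

variable {T : ℝ}

/-- The distortion `sup_{s ≠ t} |log ((l t - l s) / (t - s))|` of a time change `l`. -/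
def distortion (l : Icc (0 : ℝ) T ≃o Icc (0 : ℝ) T) : ℝ≥0∞ :=
  ⨆ (s : Icc (0 : ℝ) T) (t : Icc (0 : ℝ) T) (_ : s ≠ t),
    ENNReal.ofReal |Real.log (((l t : ℝ) - l s) / ((t : ℝ) - s))|

/-- The quantity minimised over the increasing homeomorphisms `l` of `[0,T]` in the
Skorokhod (Billingsley) metric. -/
def cost {S : Type*} [PseudoEMetricSpace S] (u v : Icc (0 : ℝ) T → S)
    (l : Icc (0 : ℝ) T ≃o Icc (0 : ℝ) T) : ℝ≥0∞ :=
  (⨆ t, edist (u t) (v (l t))) + (⨆ t, edist t (l t)) + distortion l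

lemma distortion_refl : distortion (OrderIso.refl (Icc (0 : ℝ) T)) = 0 := by
  simp only [distortion, ENNReal.iSup_eq_zero]
  intro s t hst
  have h : (t : ℝ) - s ≠ 0 := sub_ne_zero.2 fun h => hst (Subtype.ext h.symm)
  simp [div_self h]

lemma distortion_symm_le (l : Icc (0 : ℝ) T ≃o Icc (0 : ℝ) T) :
    distortion l.symm ≤ distortion l := by
  refine iSup_le fun s => iSup_le fun t => iSup_le fun hst => ?_
  have h := le_iSup_of_le (f := fun s' : Icc (0 : ℝ) T => ⨆ (t' : Icc (0 : ℝ) T) (_ : s' ≠ t'),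
    ENNReal.ofReal |Real.log (((l t' : ℝ) - l s') / ((t' : ℝ) - s'))|) (l.symm s)
    (le_iSup_of_le (l.symm t) (le_iSup_of_le (fun h => hst (l.symm.injective h)) le_rfl))
  refine le_trans (le_of_eq ?_) h
  rw [l.apply_symm_apply, l.apply_symm_apply, ← inv_div, Real.log_inv, abs_neg]

lemma distortion_trans_le (l m : Icc (0 : ℝ) T ≃o Icc (0 : ℝ) T) :
    distortion (l.trans m) ≤ distortion l + distortion m := by
  refine iSup_le fun s => iSup_le fun t => iSup_le fun hst => ?_
  have h₁ : ENNReal.ofReal |Real.log (((l t : ℝ) - l s) / ((t : ℝ) - s))| ≤ distortion l :=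
    le_iSup_of_le s (le_iSup_of_le t (le_iSup_of_le hst le_rfl))
  have hl : l s ≠ l t := fun h => hst (l.injective h)
  have h₂ : ENNReal.ofReal |Real.log (((m (l t) : ℝ) - m (l s)) / ((l t : ℝ) - l s))|
      ≤ distortion m :=
    le_iSup_of_le (l s) (le_iSup_of_le (l t) (le_iSup_of_le hl le_rfl))
  have hm : m (l s) ≠ m (l t) := fun h => hl (m.injective h)
  have e₁ : (t : ℝ) - s ≠ 0 := sub_ne_zero.2 fun h => hst (Subtype.ext h.symm)
  have e₂ : (l t : ℝ) - l s ≠ 0 := sub_ne_zero.2 fun h => hl (Subtype.ext h.symm)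
  have e₃ : (m (l t) : ℝ) - m (l s) ≠ 0 := sub_ne_zero.2 fun h => hm (Subtype.ext h.symm)
  have e : Real.log ((((l.trans m) t : ℝ) - (l.trans m) s) / ((t : ℝ) - s))
      = Real.log (((l t : ℝ) - l s) / ((t : ℝ) - s))
        + Real.log (((m (l t) : ℝ) - m (l s)) / ((l t : ℝ) - l s)) := by
    rw [← Real.log_mul (div_ne_zero e₂ e₁) (div_ne_zero e₃ e₂)]
    congr 1
    simp only [OrderIso.trans_apply]
    field_simp
  calc ENNReal.ofReal |Real.log ((((l.trans m) t : ℝ) - (l.trans m) s) / ((t : ℝ) - s))|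
      ≤ ENNReal.ofReal (|Real.log (((l t : ℝ) - l s) / ((t : ℝ) - s))|
        + |Real.log (((m (l t) : ℝ) - m (l s)) / ((l t : ℝ) - l s))|) := by
        rw [e]; exact ENNReal.ofReal_le_ofReal (abs_add_le _ _)
    _ = _ := ENNReal.ofReal_add (abs_nonneg _) (abs_nonneg _)
    _ ≤ _ := add_le_add h₁ h₂

variable {S : Type*} [PseudoEMetricSpace S]

lemma cost_refl (u : Icc (0 : ℝ) T → S) : cost u u (OrderIso.refl _) = 0 := by
  simp [cost, distortion_refl]

lemma cost_symm_le (u v : Icc (0 : ℝ) T → S) (l : Icc (0 : ℝ) T ≃o Icc (0 : ℝ) T) :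
    cost v u l.symm ≤ cost u v l := by
  refine add_le_add (add_le_add (iSup_le fun t => ?_) (iSup_le fun t => ?_))
    (distortion_symm_le l)
  · refine le_iSup_of_le (l.symm t) ?_
    rw [l.apply_symm_apply, edist_comm]
  · refine le_iSup_of_le (l.symm t) ?_
    rw [l.apply_symm_apply, edist_comm]

lemma cost_trans_le (u v w : Icc (0 : ℝ) T → S) (l m : Icc (0 : ℝ) T ≃o Icc (0 : ℝ) T) :
    cost u w (l.trans m) ≤ cost u v l + cost v w m := by
  have h₁ : (⨆ t, edist (u t) (w ((l.trans m) t)))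
      ≤ (⨆ t, edist (u t) (v (l t))) + ⨆ t, edist (v t) (w (m t)) :=
    iSup_le fun t => (edist_triangle _ (v (l t)) _).trans
      (add_le_add (le_iSup (fun t => edist (u t) (v (l t))) t)
        (le_iSup (fun t => edist (v t) (w (m t))) (l t)))
  have h₂ : (⨆ t, edist t ((l.trans m) t)) ≤ (⨆ t, edist t (l t)) + ⨆ t, edist t (m t) :=
    iSup_le fun t => (edist_triangle _ (l t) _).trans
      (add_le_add (le_iSup (fun t => edist t (l t)) t)
        (le_iSup (fun t => edist t (m t)) (l t)))
  refine (add_le_add (add_le_add h₁ h₂) (distortion_trans_le l m)).trans (le_of_eq ?_)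
  simp only [cost]
  ring

end Skorokhod

/-- The Skorokhod metric
`ρ(u,v) = inf_l [sup_t d(u(t), v(l(t))) + sup_t |t - l(t)| + sup_{s≠t} |log ((l t - l s)/(t - s))|]`
on `𝔻([0,T], S)`, the infimum being over all increasing homeomorphisms `l` of `[0,T]`. -/
instance CadlagPath.instPseudoEMetricSpace {T : ℝ} {S : Type*} [PseudoEMetricSpace S] :
    PseudoEMetricSpace (CadlagPath T S) where
  edist u v := ⨅ l : Icc (0 : ℝ) T ≃o Icc (0 : ℝ) T, Skorokhod.cost u.toFun v.toFun l
  edist_self u := le_antisymm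
    ((iInf_le _ (OrderIso.refl _)).trans (Skorokhod.cost_refl _).le) bot_le
  edist_comm u v := le_antisymm
    (le_iInf fun l => (iInf_le _ l.symm).trans (Skorokhod.cost_symm_le _ _ _))
    (le_iInf fun l => (iInf_le _ l.symm).trans (Skorokhod.cost_symm_le _ _ _))
  edist_triangle u v w := ENNReal.le_iInf_add_iInf fun l m =>
    (iInf_le _ (l.trans m)).trans (Skorokhod.cost_trans_le _ _ _ _ _)

/-- The set `𝔻_w([0,T], X)` of weakly càdlàg functions with values in a complex normed space. -/
structure WeaklyCadlagPath (T : ℝ) (X : Type*) [NormedAddCommGroup X] [NormedSpace ℂ X] where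
  toFun : Icc (0 : ℝ) T → X
  isCadlag : ∀ φ : StrongDual ℂ X, IsCadlag fun t => φ (toFun t)

/-- The topology of `𝔻_w([0,T], X)`: the weakest one for which `u ↦ ⟨u(·), φ⟩` is continuous into
the Skorokhod space `𝔻([0,T], ℂ)` for every `φ` in the dual of `X`. -/
instance WeaklyCadlagPath.instTopologicalSpace {T : ℝ} {X : Type*} [NormedAddCommGroup X]
    [NormedSpace ℂ X] : TopologicalSpace (WeaklyCadlagPath T X) :=
  ⨅ φ : StrongDual ℂ X, TopologicalSpace.induced
    (fun u => (⟨fun t => φ (u.toFun t), u.isCadlag φ⟩ : CadlagPath T ℂ)) inferInstance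

/-! ### The energy space and its dual -/

/-- A (possibly unbounded) non-negative self-adjoint operator on a complex Hilbert space. -/
structure NonnegSelfAdjointOp (H : Type*) [NormedAddCommGroup H] [InnerProductSpace ℂ H]
    [CompleteSpace H] where
  op : H →ₗ.[ℂ] H
  isSelfAdjoint : IsSelfAdjoint op
  nonneg : ∀ x : op.domain, 0 ≤ (inner ℂ (op x) (x : H)).re

namespace NonnegSelfAdjointOp

variable {H : Type*} [NormedAddCommGroup H] [InnerProductSpace ℂ H] [CompleteSpace H]
  (A : NonnegSelfAdjointOp H)

/-- `Id + A`, as a linear map on the domain of `A`. -/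
def oneAdd : A.op.domain →ₗ[ℂ] H := A.op.domain.subtype + A.op.toFun

lemma oneAdd_apply (x : A.op.domain) : A.oneAdd x = (x : H) + A.op x := rfl

lemma inner_op_left (x y : A.op.domain) :
    inner ℂ (A.op x) (y : H) = inner ℂ (x : H) (A.op y) := by
  have h := LinearPMap.adjoint_isFormalAdjoint A.isSelfAdjoint.dense_domain
  rw [LinearPMap.isSelfAdjoint_def.1 A.isSelfAdjoint] at h
  exact h x y

lemma norm_le_norm_oneAdd (x : A.op.domain) : ‖(x : H)‖ ≤ ‖A.oneAdd x‖ := by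
  have h₁ : ‖(x : H)‖ * ‖(x : H)‖ ≤ ‖A.oneAdd x‖ * ‖(x : H)‖ := by
    calc ‖(x : H)‖ * ‖(x : H)‖
        ≤ (inner ℂ (x : H) (x : H)).re + (inner ℂ (A.op x) (x : H)).re := by
          have := inner_self_eq_norm_mul_norm (𝕜 := ℂ) (x : H)
          simp only [RCLike.re_to_complex] at this
          have := A.nonneg x
          linarith
      _ = (inner ℂ (A.oneAdd x) (x : H)).re := by
          rw [oneAdd_apply, inner_add_left, Complex.add_re]
      _ ≤ ‖inner ℂ (A.oneAdd x) (x : H)‖ := Complex.re_le_norm _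
      _ ≤ _ := norm_inner_le_norm _ _
  rcases (norm_nonneg (x : H)).eq_or_lt with h | h
  · rw [← h]; exact norm_nonneg _
  · exact le_of_mul_le_mul_right h₁ h

lemma oneAdd_injective : Function.Injective A.oneAdd := by
  rw [injective_iff_map_eq_zero]
  intro x hx
  have := A.norm_le_norm_oneAdd x
  rw [hx, norm_zero] at this
  exact Subtype.ext (norm_le_zero_iff.1 this)

lemma isClosed_range_oneAdd : IsClosed (LinearMap.range A.oneAdd : Set H) := by
  refine isClosed_of_closure_subset fun y hy => ?_
  obtain ⟨s, hs, hlim⟩ := mem_closure_iff_seq_limit.1 hy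
  choose x hx using hs
  have hc : CauchySeq fun n => (x n : H) := by
    refine Metric.cauchySeq_iff'.2 fun ε hε => ?_
    obtain ⟨N, hN⟩ := Metric.cauchySeq_iff'.1 hlim.cauchySeq ε hε
    refine ⟨N, fun n hn => lt_of_le_of_lt ?_ (hN n hn)⟩
    have := A.norm_le_norm_oneAdd (x n - x N)
    rwa [map_sub, hx, hx, Submodule.coe_sub, ← dist_eq_norm, ← dist_eq_norm] at this
  obtain ⟨z, hz⟩ := cauchySeq_tendsto_of_complete hc
  have hA : Tendsto (fun n => A.op (x n)) atTop (𝓝 (y - z)) := by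
    refine (hlim.sub hz).congr fun n => ?_
    rw [← hx, oneAdd_apply, add_sub_cancel_left]
  have hg : (z, y - z) ∈ A.op.graph :=
    (A.isSelfAdjoint.isClosed).mem_of_tendsto (hz.prodMk_nhds hA)
      (Eventually.of_forall fun n => A.op.mem_graph (x n))
  obtain ⟨w, hw₁, hw₂⟩ := (LinearPMap.mem_graph_iff _).1 hg
  refine ⟨w, ?_⟩
  rw [oneAdd_apply, hw₁, hw₂, add_sub_cancel]

lemma oneAdd_surjective : Function.Surjective A.oneAdd := by
  have : CompleteSpace (LinearMap.range A.oneAdd) :=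
    A.isClosed_range_oneAdd.completeSpace_coe
  rw [← LinearMap.range_eq_top, ← Submodule.orthogonal_eq_bot_iff, Submodule.eq_bot_iff]
  intro y hy
  have h : ∀ x : A.op.domain, inner ℂ (-y) (x : H) = inner ℂ y (A.op x) := by
    intro x
    have := (Submodule.mem_orthogonal' _ _).1 hy (A.oneAdd x) ⟨x, rfl⟩
    rw [oneAdd_apply, inner_add_right] at this
    rw [inner_neg_left]
    exact neg_eq_of_add_eq_zero_right this
  have hd := A.isSelfAdjoint.dense_domain
  have hmem := LinearPMap.mem_adjoint_domain_of_exists (T := A.op) y ⟨-y, h⟩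
  have hval := LinearPMap.adjoint_apply_eq hd ⟨y, hmem⟩ h
  have hg : (y, -y) ∈ A.op.graph := by
    rw [← LinearPMap.isSelfAdjoint_def.1 A.isSelfAdjoint, LinearPMap.mem_graph_iff]
    exact ⟨⟨y, hmem⟩, rfl, hval⟩
  obtain ⟨w, hw₁, hw₂⟩ := (LinearPMap.mem_graph_iff _).1 hg
  have h0 : w = 0 := by
    apply A.oneAdd_injective
    rw [oneAdd_apply, hw₁, hw₂, add_neg_cancel, map_zero]
  simpa [h0] using hw₁.symm

/-- The resolvent `(Id + A)⁻¹` as a bounded operator on `H`. -/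
def resolvent : H →L[ℂ] H :=
  (A.op.domain.subtype ∘ₗ
    (LinearEquiv.ofBijective A.oneAdd ⟨A.oneAdd_injective, A.oneAdd_surjective⟩).symm.toLinearMap
    ).mkContinuous 1 fun y => by
      obtain ⟨x, rfl⟩ := A.oneAdd_surjective y
      rw [one_mul]
      refine le_trans (le_of_eq ?_) (A.norm_le_norm_oneAdd x)
      exact congrArg (fun z : A.op.domain => ‖(z : H)‖) (LinearEquiv.ofBijective_symm_apply_apply
        A.oneAdd x)

lemma resolvent_oneAdd (x : A.op.domain) : A.resolvent (A.oneAdd x) = x :=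
  congrArg (Subtype.val : A.op.domain → H) (LinearEquiv.ofBijective_symm_apply_apply A.oneAdd x)

lemma resolvent_injective : Function.Injective A.resolvent := by
  rw [injective_iff_map_eq_zero]
  intro y hy
  obtain ⟨x, rfl⟩ := A.oneAdd_surjective y
  rw [resolvent_oneAdd] at hy
  rw [show x = 0 from Subtype.ext hy, map_zero]

lemma resolvent_nonneg : 0 ≤ A.resolvent := by
  rw [ContinuousLinearMap.nonneg_iff_isPositive, ContinuousLinearMap.isPositive_def']
  constructor
  · rw [ContinuousLinearMap.isSelfAdjoint_iff_isSymmetric]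
    intro y z
    obtain ⟨x, rfl⟩ := A.oneAdd_surjective y
    obtain ⟨w, rfl⟩ := A.oneAdd_surjective z
    simp only [ContinuousLinearMap.coe_coe, resolvent_oneAdd]
    rw [oneAdd_apply, oneAdd_apply, inner_add_left, inner_add_right, inner_op_left]
  · intro y
    obtain ⟨x, rfl⟩ := A.oneAdd_surjective y
    rw [ContinuousLinearMap.reApplyInnerSelf_apply, resolvent_oneAdd, oneAdd_apply,
      inner_add_right, ← inner_op_left, map_add]
    exact add_nonneg inner_self_nonneg (A.nonneg x)

/-- `(Id + A)^{-1/2}`: the positive square root of the bounded positive operator `(Id + A)⁻¹`. -/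
def invSqrt : H →L[ℂ] H := CFC.sqrt A.resolvent

lemma invSqrt_injective : Function.Injective A.invSqrt := by
  have h : A.invSqrt * A.invSqrt = A.resolvent :=
    CFC.sqrt_mul_sqrt_self _ A.resolvent_nonneg
  refine Function.Injective.of_comp (f := A.invSqrt) ?_
  have h' : (A.invSqrt ∘ A.invSqrt : H → H) = A.resolvent := by
    rw [← h]; rfl
  rw [h']
  exact A.resolvent_injective

/-- `(Id + A)^{1/2}`: the inverse of `(Id + A)^{-1/2}`, an unbounded operator on `H` whose domain
is the range of `(Id + A)^{-1/2}`. -/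
def sqrtOneAdd : H →ₗ.[ℂ] H := ((A.invSqrt : H →ₗ[ℂ] H).toPMap ⊤).inverse

lemma ker_invSqrt : LinearMap.ker ((A.invSqrt : H →ₗ[ℂ] H).toPMap ⊤).toFun = ⊥ := by
  rw [LinearMap.ker_eq_bot']
  intro x hx
  exact Subtype.ext (A.invSqrt_injective (hx.trans (map_zero A.invSqrt).symm))

lemma mem_domain_sqrtOneAdd (x : H) :
    x ∈ A.sqrtOneAdd.domain ↔ ∃ y, A.invSqrt y = x := by
  rw [sqrtOneAdd, LinearPMap.inverse_domain]
  constructor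
  · rintro ⟨y, rfl⟩; exact ⟨y, rfl⟩
  · rintro ⟨y, rfl⟩; exact ⟨⟨y, trivial⟩, rfl⟩

lemma invSqrt_sqrtOneAdd (x : A.sqrtOneAdd.domain) : A.invSqrt (A.sqrtOneAdd x) = x := by
  obtain ⟨y, hy⟩ := (A.mem_domain_sqrtOneAdd x).1 x.2
  have h : A.sqrtOneAdd x = y :=
    LinearPMap.inverse_apply_eq A.ker_invSqrt (x := ⟨y, trivial⟩) hy
  rw [h, hy]

lemma sqrtOneAdd_injective : Function.Injective A.sqrtOneAdd.toFun := by
  intro x y h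
  have := congrArg A.invSqrt (show A.sqrtOneAdd x = A.sqrtOneAdd y from h)
  rw [invSqrt_sqrtOneAdd, invSqrt_sqrtOneAdd] at this
  exact Subtype.ext this

/-- The energy space `E_A = D((Id + A)^{1/2})`. -/
def EnergySpace : Type _ := A.sqrtOneAdd.domain

instance : AddCommGroup A.EnergySpace := inferInstanceAs (AddCommGroup A.sqrtOneAdd.domain)

instance : Module ℂ A.EnergySpace := inferInstanceAs (Module ℂ A.sqrtOneAdd.domain)

/-- The inclusion of the energy space into `H`. -/
def energyToH : A.EnergySpace →ₗ[ℂ] H := A.sqrtOneAdd.domain.subtype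

/-- `(Id + A)^{1/2}` as a map on the energy space. -/
def energySqrt : A.EnergySpace →ₗ[ℂ] H := A.sqrtOneAdd.toFun

/-- The norm `‖x‖ = ‖(Id + A)^{1/2} x‖` of the energy space. -/
instance : NormedAddCommGroup A.EnergySpace :=
  NormedAddCommGroup.induced A.EnergySpace H A.energySqrt A.sqrtOneAdd_injective

instance : NormedSpace ℂ A.EnergySpace := NormedSpace.induced ℂ A.EnergySpace H A.energySqrt

/-- The inner product `⟪x, y⟫ = ⟪(Id + A)^{1/2} x, (Id + A)^{1/2} y⟫` of the energy space. -/
instance : InnerProductSpace ℂ A.EnergySpace where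
  inner x y := inner ℂ (A.energySqrt x) (A.energySqrt y)
  norm_sq_eq_re_inner x := norm_sq_eq_re_inner (𝕜 := ℂ) (A.energySqrt x)
  conj_inner_symm x y := inner_conj_symm (𝕜 := ℂ) (A.energySqrt x) (A.energySqrt y)
  add_left x y z := by rw [map_add, inner_add_left]
  smul_left x y r := by rw [map_smul, inner_smul_left]

/-- The space `H`, to be equipped with the norm `‖x‖ = ‖(Id + A)^{-1/2} x‖`. -/
def PreDual (_ : NonnegSelfAdjointOp H) : Type _ := H

instance : AddCommGroup A.PreDual := inferInstanceAs (AddCommGroup H)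

instance : Module ℂ A.PreDual := inferInstanceAs (Module ℂ H)

/-- The identity map from `H` to `H` with the norm `‖(Id + A)^{-1/2} x‖`. -/
def toPreDual : H →ₗ[ℂ] A.PreDual := LinearMap.id

/-- `(Id + A)^{-1/2}` as a map on `PreDual`. -/
def preDualInvSqrt : A.PreDual →ₗ[ℂ] H := (A.invSqrt : H →ₗ[ℂ] H)

instance : NormedAddCommGroup A.PreDual :=
  NormedAddCommGroup.induced A.PreDual H A.preDualInvSqrt A.invSqrt_injective

instance : NormedSpace ℂ A.PreDual := NormedSpace.induced ℂ A.PreDual H A.preDualInvSqrt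

instance : InnerProductSpace ℂ A.PreDual where
  inner x y := inner ℂ (A.preDualInvSqrt x) (A.preDualInvSqrt y)
  norm_sq_eq_re_inner x := norm_sq_eq_re_inner (𝕜 := ℂ) (A.preDualInvSqrt x)
  conj_inner_symm x y := inner_conj_symm (𝕜 := ℂ) (A.preDualInvSqrt x) (A.preDualInvSqrt y)
  add_left x y z := by rw [map_add, inner_add_left]
  smul_left x y r := by rw [map_smul, inner_smul_left]

/-- The dual energy space `E_A^* = H_{-1/2}`: the completion of `H` with respect to the norm
`‖(Id + A)^{-1/2} x‖`. -/
abbrev DualEnergySpace : Type _ := UniformSpace.Completion A.PreDual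

/-- The embedding of `E_A` into `E_A^*` (through `H`). -/
def energyToDual : A.EnergySpace →ₗ[ℂ] A.DualEnergySpace :=
  (UniformSpace.Completion.toComplₗᵢ (𝕜 := ℂ) (E := A.PreDual)).toLinearMap ∘ₗ
    A.toPreDual ∘ₗ A.energyToH

/-- The `E_A`-norm as a `[0,∞]`-valued function on `E_A^*`, equal to `∞` outside `E_A`. -/
def energyENorm (y : A.DualEnergySpace) : ℝ≥0∞ :=
  ⨅ (x : A.EnergySpace) (_ : A.energyToDual x = y), ‖x‖ₑ

end NonnegSelfAdjointOp

/-! ### The embedding of the energy space into `L^p(M)` and the path space `Z_T` -/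

section PathSpace

variable {M : Type*} [MeasurableSpace M] {μ : Measure M}

namespace NonnegSelfAdjointOp

variable (A : NonnegSelfAdjointOp (Lp ℂ 2 μ))

/-- `E_A ⊆ L^p(M)`. -/
def EnergySubsetLp (p : ℝ≥0∞) : Prop :=
  ∀ x : A.EnergySpace, MemLp (A.energyToH x : M → ℂ) p μ

variable {A} in
/-- The inclusion map of `E_A` into `L^p(M)`. -/
def EnergySubsetLp.incl {p : ℝ≥0∞} (h : A.EnergySubsetLp p) : A.EnergySpace →ₗ[ℂ] Lp ℂ p μ where
  toFun x := (h x).toLp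
  map_add' x y := by
    rw [← MemLp.toLp_add, MemLp.toLp_eq_toLp_iff, map_add]
    exact Lp.coeFn_add _ _
  map_smul' c x := by
    rw [RingHom.id_apply, ← MemLp.toLp_const_smul, MemLp.toLp_eq_toLp_iff, map_smul]
    exact Lp.coeFn_smul _ _

end NonnegSelfAdjointOp

instance {α : ℝ} [h : Fact (1 < α)] : Fact (1 ≤ ENNReal.ofReal (α + 1)) :=
  ⟨ENNReal.one_le_ofReal.2 (by linarith [h.out])⟩

/-- Lebesgue measure on `[0,T]`. -/
def timeMeasure (T : ℝ) : Measure (Icc (0 : ℝ) T) := Measure.comap Subtype.val volume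

/-- The path space
`Z_T = 𝔻([0,T], E_A^*) ∩ L^p(0,T; L^p(M)) ∩ 𝔻_w([0,T], E_A)` (used with `p = α + 1`): functions
`[0,T] → E_A` that belong to each of the three spaces, along the embeddings of `E_A` into `E_A^*`
and into `L^p(M)`. -/
structure EnergyPath (A : NonnegSelfAdjointOp (Lp ℂ 2 μ)) {p : ℝ≥0∞} [Fact (1 ≤ p)]
    (hp : A.EnergySubsetLp p) (T : ℝ) where
  toFun : Icc (0 : ℝ) T → A.EnergySpace
  isCadlag_dual : IsCadlag fun t => A.energyToDual (toFun t)
  memLp : MemLp (fun t => hp.incl (toFun t)) p (timeMeasure T)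
  isCadlag_weak : ∀ φ : StrongDual ℂ A.EnergySpace, IsCadlag fun t => φ (toFun t)

namespace EnergyPath

variable {A : NonnegSelfAdjointOp (Lp ℂ 2 μ)} {p : ℝ≥0∞} [Fact (1 ≤ p)]
  {hp : A.EnergySubsetLp p} {T : ℝ}

/-- The inclusion of `Z_T` into `𝔻([0,T], E_A^*)`. -/
def toCadlag (u : EnergyPath A hp T) : CadlagPath T A.DualEnergySpace :=
  ⟨fun t => A.energyToDual (u.toFun t), u.isCadlag_dual⟩

/-- The inclusion of `Z_T` into `L^p(0,T; L^p(M))`. -/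
def toLp (u : EnergyPath A hp T) :
    Lp (Lp ℂ p μ) p (timeMeasure T) :=
  u.memLp.toLp

/-- The inclusion of `Z_T` into `𝔻_w([0,T], E_A)`. -/
def toWeaklyCadlag (u : EnergyPath A hp T) : WeaklyCadlagPath T A.EnergySpace :=
  ⟨u.toFun, u.isCadlag_weak⟩

/-- The topology of `Z_T`: the smallest one containing the traces of the topologies of the three
spaces. -/
instance : TopologicalSpace (EnergyPath A hp T) :=
  TopologicalSpace.induced toCadlag inferInstance ⊓
    TopologicalSpace.induced toLp inferInstance ⊓
    TopologicalSpace.induced toWeaklyCadlag inferInstance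

/-- `Z_T` carries its Borel σ-algebra. -/
instance : MeasurableSpace (EnergyPath A hp T) := borel _

end EnergyPath

end PathSpace

/-! ### The Aldous condition -/

/-- The Aldous condition for a sequence of processes `X n` on `[0,T]` with values in `E`, with
respect to the filtration `𝓕`. -/
def AldousCondition {Ω E : Type*} {mΩ : MeasurableSpace Ω} [NormedAddCommGroup E] {T : ℝ}
    (hT : 0 ≤ T) (P : Measure Ω) (𝓕 : Filtration (Icc (0 : ℝ) T) mΩ)
    (X : ℕ → Icc (0 : ℝ) T → Ω → E) : Prop :=
  ∀ ε : ℝ, 0 < ε → ∀ η : ℝ, 0 < η → ∃ δ : ℝ, 0 < δ ∧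
    ∀ τ : ℕ → Ω → Icc (0 : ℝ) T,
      (∀ n, IsStoppingTime 𝓕 fun ω => (τ n ω : WithTop (Icc (0 : ℝ) T))) →
      ∀ n : ℕ, ∀ θ : ℝ, 0 < θ → θ ≤ δ →
        P {ω | η ≤ ‖X n (projIcc 0 T hT ((τ n ω : ℝ) + θ)) ω - X n (τ n ω) ω‖}
          ≤ ENNReal.ofReal ε

/-- The usual conditions for a filtration: the probability space is complete, every `𝓕 t` contains
all null sets, and `𝓕` is right-continuous. -/
structure UsualConditions {Ω ι : Type*} {mΩ : MeasurableSpace Ω} [PartialOrder ι]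
    (P : Measure Ω) (𝓕 : Filtration ι mΩ) : Prop where
  complete : P.IsComplete
  null : ∀ t s, P s = 0 → MeasurableSet[𝓕 t] s
  rightCont : 𝓕.IsRightContinuous

end

/-!
The proof rests on one observation: on the part `ball R` of `Z_T` consisting of the paths with
values in the ball of radius `R` of `E_A`, the three topologies collapse to a single one, that of
the Skorokhod metric of `𝔻([0,T], E_A^*)` (`EnergyPath.isInducing_toCadlag`). For `𝔻_w` this is because
the functionals on `E_A` that extend to `E_A^*` are dense, so that on `ball R` every functional is
a uniform limit of continuous ones. For `L^p(0,T; L^p(M))`, Skorokhod convergence gives convergence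
in `E_A^*` at all but countably many times; since `E_A` embeds compactly into `L^p(M)`, which embeds
into `E_A^*`, bounded sequences converging in `E_A^*` converge in `L^p(M)`, and dominated
convergence applies. Moreover a càdlàg path in `E_A^*` with energy bounded by `R` belongs to `Z_T`
(`EnergyPath.exists_of_bounded`), and such paths form a closed set because balls of `E_A` are closed
in `E_A^*` (`lowerSemicontinuous_energyENorm`). Hence both measurability in `Z_T` and compactness in
`Z_T` reduce to the same questions in the Skorokhod space of `E_A^*`, a complete space.

The Skorokhod space is handled through discretization along the grids `{i T / N}`. If `u`
oscillates by at most `ε` along a partition with mesh `δ`, then the discretization of `u` is at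
distance about `ε` from `u` as soon as `T / N` is small compared with `δ`
(`edist_discretize_le`): the time change moves the points of the partition to grid points, its
displacement being a McShane extension with small Lipschitz constant. Thus discretizations of a
càdlàg path converge to it, which makes random paths measurable, and a family of paths in a compact
set with uniformly convergent discretizations is relatively compact
(`isCompact_closure_of_discretize`).

It remains to show that the discretizations converge in probability uniformly in `n`
(`exists_measure_lt_edist_discretize_le`). By passing to finer and finer grids this only concerns
processes in discrete time, where the argument of Aldous uses nothing but finite-valued stopping
times. Averaging over the shift `k` in the Aldous condition bounds the increment between two
stopping times that are close to each other (`measure_increment_le`). Applied to the successive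
times at which the process has moved by `2 η`, this bounds the number of these times, then their
distances, and finally the increments near `T`; together these give a partition with small
oscillation (`measure_not_hasOscPartition_le`).
-/

noncomputable section

open scoped NNReal

/-! ### Càdlàg functions -/

section Cadlag

variable {ι S S' : Type*} [TopologicalSpace ι]

lemma isCadlag_const [Preorder ι] [TopologicalSpace S] (c : S) :
    IsCadlag fun _ : ι => c :=
  fun _ => ⟨continuousWithinAt_const, c, tendsto_const_nhds⟩

lemma IsCadlag.continuous_comp [Preorder ι] [TopologicalSpace S] [TopologicalSpace S']
    {f : ι → S} (hf : IsCadlag f) {g : S → S'} (hg : Continuous g) :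
    IsCadlag fun t => g (f t) := fun t => by
  refine ⟨hg.continuousAt.comp_continuousWithinAt (hf t).1, ?_⟩
  obtain ⟨l, hl⟩ := (hf t).2
  exact ⟨g l, (hg.tendsto l).comp hl⟩

lemma IsCadlag.comp_orderIso [LinearOrder ι] [OrderTopology ι] [TopologicalSpace S]
    {f : ι → S} (hf : IsCadlag f) (l : ι ≃o ι) : IsCadlag fun t => f (l t) := fun t => by
  refine ⟨(hf (l t)).1.comp l.continuous.continuousWithinAt fun s hs => l.monotone hs, ?_⟩
  obtain ⟨a, ha⟩ := (hf (l t)).2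
  exact ⟨a, ha.comp (tendsto_nhdsWithin_of_tendsto_nhds_of_eventually_within _
    (l.continuous.continuousAt.tendsto.mono_left nhdsWithin_le_nhds)
    (eventually_mem_nhdsWithin.mono fun s hs => l.strictMono hs))⟩

/-- A uniform limit of càdlàg functions with values in a complete space is càdlàg. -/
lemma isCadlag_of_approx [Preorder ι] [PseudoMetricSpace S] [CompleteSpace S] {f : ι → S}
    (h : ∀ ε : ℝ, 0 < ε → ∃ g : ι → S, IsCadlag g ∧ ∀ t, dist (f t) (g t) ≤ ε) :
    IsCadlag f := by
  intro t
  constructor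
  · refine Metric.tendsto_nhds.2 fun ε hε => ?_
    obtain ⟨g, hg, hfg⟩ := h (ε / 4) (by positivity)
    filter_upwards [Metric.tendsto_nhds.1 (hg t).1 (ε / 2) (by positivity)] with s hs
    have h₁ := dist_triangle4 (f s) (g s) (g t) (f t)
    have h₂ := hfg s
    have h₃ := hfg t
    rw [dist_comm] at h₃
    linarith
  · rcases (𝓝[<] t).eq_or_neBot with hbot | hne
    · exact ⟨f t, by rw [hbot]; exact tendsto_bot⟩
    refine CompleteSpace.complete (f := map f (𝓝[<] t)) (Metric.cauchy_iff.2 ⟨hne.map f, ?_⟩)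
    intro ε hε
    obtain ⟨g, hg, hfg⟩ := h (ε / 4) (by positivity)
    obtain ⟨l, hl⟩ := (hg t).2
    obtain ⟨V, hV, hVε⟩ := (Metric.cauchy_iff.1 hl.cauchy_map).2 (ε / 2) (by positivity)
    refine ⟨f '' (g ⁻¹' V), image_mem_map hV, ?_⟩
    rintro _ ⟨a, ha, rfl⟩ _ ⟨b, hb, rfl⟩
    have h₀ := hVε _ ha _ hb
    have h₁ := dist_triangle4 (f a) (g a) (g b) (f b)
    have h₂ := hfg a
    have h₃ := hfg b
    rw [dist_comm] at h₃
    linarith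

/-- A function factoring through `t ↦ ⌊c * t⌋` is a càdlàg step function. -/
lemma isCadlag_comp_floor {T : ℝ} [TopologicalSpace S] (g : ℤ → S) {c : ℝ} (hc : 0 ≤ c) :
    IsCadlag fun t : Icc (0 : ℝ) T => g ⌊c * t⌋ := by
  rcases hc.eq_or_lt with rfl | hc
  · simpa using isCadlag_const (g 0)
  intro t
  have hcont : Continuous fun s : Icc (0 : ℝ) T => c * (s : ℝ) := by fun_prop
  have key : ∀ (A : Set (Icc (0 : ℝ) T)) (B : Set ℝ)
      (_ : MapsTo (fun s : Icc (0 : ℝ) T => c * (s : ℝ)) A B),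
      Tendsto (fun s : Icc (0 : ℝ) T => c * (s : ℝ)) (𝓝[A] t) (𝓝[B] (c * t)) :=
    fun A B h => hcont.continuousWithinAt.tendsto_nhdsWithin h
  refine ⟨?_, g (⌈c * t⌉ - 1), ?_⟩
  · have := (tendsto_floor_right_pure_floor (c * (t : ℝ))).comp
      (key (Ici t) (Ici (c * t)) fun s hs => mul_le_mul_of_nonneg_left (Subtype.coe_le_coe.2 hs)
        hc.le)
    exact ((tendsto_pure_pure g _).comp this).mono_right (pure_le_nhds _)
  · have := (tendsto_floor_left_pure_ceil_sub_one (c * (t : ℝ))).comp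
      (key (Iio t) (Iio (c * t)) fun s hs => mul_lt_mul_of_pos_left (Subtype.coe_lt_coe.2 hs) hc)
    exact ((tendsto_pure_pure g _).comp this).mono_right (pure_le_nhds _)

end Cadlag

/-! ### Time changes -/

namespace Skorokhod

variable {T : ℝ}

/-- The distortion of a time change is at most `c` as soon as all its slopes lie in
`[exp (-c), exp c]`. -/
lemma distortion_le_of_slopes (l : Icc (0 : ℝ) T ≃o Icc (0 : ℝ) T) {c : ℝ}
    (h : ∀ s t : Icc (0 : ℝ) T, s < t → Real.exp (-c) * ((t : ℝ) - s) ≤ (l t : ℝ) - l s ∧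
      (l t : ℝ) - l s ≤ Real.exp c * ((t : ℝ) - s)) :
    distortion l ≤ ENNReal.ofReal c := by
  have key : ∀ s t : Icc (0 : ℝ) T, s < t →
      ENNReal.ofReal |Real.log (((l t : ℝ) - l s) / ((t : ℝ) - s))| ≤ ENNReal.ofReal c := by
    intro s t hst
    have h₀ : 0 < (t : ℝ) - s := sub_pos.2 hst
    have h₁ : 0 < (l t : ℝ) - l s := sub_pos.2 (l.strictMono hst)
    obtain ⟨ha, hb⟩ := h s t hst
    refine ENNReal.ofReal_le_ofReal (abs_le.2 ⟨?_, ?_⟩)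
    · exact (Real.le_log_iff_exp_le (div_pos h₁ h₀)).2 ((le_div_iff₀ h₀).2 ha)
    · exact (Real.log_le_iff_le_exp (div_pos h₁ h₀)).2 ((div_le_iff₀ h₀).2 hb)
  refine iSup_le fun s => iSup_le fun t => iSup_le fun hst => ?_
  rcases hst.lt_or_gt with hst | hst
  · exact key s t hst
  · rw [← neg_div_neg_eq, neg_sub, neg_sub]
    exact key t s hst

lemma slopes_of_distortion_le (l : Icc (0 : ℝ) T ≃o Icc (0 : ℝ) T) {c : ℝ} (hc : 0 ≤ c)
    (h : distortion l ≤ ENNReal.ofReal c) {s t : Icc (0 : ℝ) T} (hst : s ≤ t) :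
    Real.exp (-c) * ((t : ℝ) - s) ≤ (l t : ℝ) - l s ∧
      (l t : ℝ) - l s ≤ Real.exp c * ((t : ℝ) - s) := by
  rcases hst.eq_or_lt with rfl | hst
  · simp
  have h₀ : 0 < (t : ℝ) - s := sub_pos.2 hst
  have h₁ : 0 < (l t : ℝ) - l s := sub_pos.2 (l.strictMono hst)
  have h₂ : ENNReal.ofReal |Real.log (((l t : ℝ) - l s) / ((t : ℝ) - s))| ≤ distortion l :=
    le_iSup_of_le s (le_iSup_of_le t (le_iSup_of_le hst.ne le_rfl))
  have h₃ := abs_le.1 ((ENNReal.ofReal_le_ofReal_iff hc).1 (h₂.trans h))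
  exact ⟨(le_div_iff₀ h₀).1 ((Real.le_log_iff_exp_le (div_pos h₁ h₀)).1 h₃.1),
    (div_le_iff₀ h₀).1 ((Real.log_le_iff_le_exp (div_pos h₁ h₀)).1 h₃.2)⟩

/-- A strictly increasing continuous function on `[0,T]` fixing the endpoints is a time change. -/
lemma exists_orderIso {f : ℝ → ℝ} (hmono : StrictMonoOn f (Icc 0 T))
    (hcont : ContinuousOn f (Icc 0 T)) (h0 : f 0 = 0) (hT : f T = T) :
    ∃ l : Icc (0 : ℝ) T ≃o Icc (0 : ℝ) T, ∀ t, (l t : ℝ) = f t := by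
  have hmem : ∀ t : Icc (0 : ℝ) T, f t ∈ Icc 0 T := fun t => by
    have hle : (0 : ℝ) ≤ T := t.2.1.trans t.2.2
    constructor
    · calc (0 : ℝ) = f 0 := h0.symm
        _ ≤ f t := hmono.monotoneOn ⟨le_rfl, hle⟩ t.2 t.2.1
    · calc f t ≤ f T := hmono.monotoneOn t.2 ⟨hle, le_rfl⟩ t.2.2
        _ = T := hT
  have hsm : StrictMono fun t : Icc (0 : ℝ) T => (⟨f t, hmem t⟩ : Icc (0 : ℝ) T) :=
    fun s t hst => hmono s.2 t.2 hst
  refine ⟨hsm.orderIsoOfSurjective _ fun y => ?_, fun t => rfl⟩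
  have hle : (0 : ℝ) ≤ T := y.2.1.trans y.2.2
  obtain ⟨x, hx, hxy⟩ := intermediate_value_Icc hle hcont (by rw [h0, hT]; exact y.2)
  exact ⟨⟨x, hx⟩, Subtype.ext hxy⟩

/-- A small Lipschitz perturbation of the identity is a time change with small distortion. -/
lemma exists_orderIso_of_lipschitz {φ : ℝ → ℝ} {K : ℝ≥0} (hK : (K : ℝ) ≤ 1 / 2)
    (hφ : LipschitzWith K φ) (h0 : φ 0 = 0) (hT : φ T = 0) :
    ∃ l : Icc (0 : ℝ) T ≃o Icc (0 : ℝ) T, (∀ t, (l t : ℝ) = t + φ t) ∧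
      (⨆ t, edist t (l t)) ≤ ENNReal.ofReal (K * T) ∧
      distortion l ≤ ENNReal.ofReal (2 * K) := by
  have hlip : ∀ s t : ℝ, s ≤ t → |φ t - φ s| ≤ K * (t - s) := fun s t hst => by
    have := hφ.dist_le_mul t s
    rwa [Real.dist_eq, Real.dist_eq, abs_of_nonneg (sub_nonneg.2 hst)] at this
  obtain ⟨l, hl⟩ := exists_orderIso (T := T) (f := fun t => t + φ t)
    (fun s _ t _ hst => by
      have := abs_le.1 (hlip s t hst.le)
      have : (K : ℝ) * (t - s) ≤ 1 / 2 * (t - s) :=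
        mul_le_mul_of_nonneg_right hK (sub_nonneg.2 hst.le)
      change s + φ s < t + φ t
      linarith)
    (continuous_id.add hφ.continuous).continuousOn (by simp [h0]) (by simp [hT])
  refine ⟨l, hl, iSup_le fun t => ?_, distortion_le_of_slopes l fun s t hst => ?_⟩
  · rw [Subtype.edist_eq, hl, edist_dist, Real.dist_eq]
    refine ENNReal.ofReal_le_ofReal ?_
    have h₁ := hlip 0 t t.2.1
    rw [h0, sub_zero, sub_zero] at h₁
    rw [sub_add_cancel_left, abs_neg]
    exact h₁.trans (mul_le_mul_of_nonneg_left t.2.2 K.2)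
  · have hst' : 0 < (t : ℝ) - s := sub_pos.2 hst
    have h₁ := abs_le.1 (hlip s t hst.le)
    rw [hl, hl]
    have e₁ : Real.exp (-(2 * K)) ≤ 1 - K := by
      have h₂ := Real.add_one_le_exp (2 * (K : ℝ))
      have h₃ : (0 : ℝ) ≤ K := K.2
      rw [Real.exp_neg, inv_le_comm₀ (Real.exp_pos _) (by linarith)]
      refine le_trans ?_ h₂
      rw [inv_le_iff_one_le_mul₀ (by linarith)]
      nlinarith
    have e₂ : 1 + (K : ℝ) ≤ Real.exp (2 * K) := by
      have h₂ := Real.add_one_le_exp (2 * (K : ℝ))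
      have h₃ : (0 : ℝ) ≤ K := K.2
      linarith
    constructor
    · have := mul_le_mul_of_nonneg_right e₁ hst'.le
      linarith
    · have := mul_le_mul_of_nonneg_right e₂ hst'.le
      linarith

end Skorokhod

/-! ### Completeness of the Skorokhod space -/

section Complete

variable {T : ℝ} {S : Type*}

lemma CadlagPath.edist_le_cost [PseudoEMetricSpace S] (u v : CadlagPath T S)
    (l : Icc (0 : ℝ) T ≃o Icc (0 : ℝ) T) : edist u v ≤ Skorokhod.cost u.toFun v.toFun l :=
  iInf_le _ l

lemma CadlagPath.exists_cost_lt [PseudoEMetricSpace S] {u v : CadlagPath T S} {r : ℝ≥0∞}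
    (h : edist u v < r) : ∃ l, Skorokhod.cost u.toFun v.toFun l < r :=
  iInf_lt_iff.1 h

lemma CadlagPath.edist_le_iSup [PseudoEMetricSpace S] (u v : CadlagPath T S) :
    edist u v ≤ ⨆ t, edist (u.toFun t) (v.toFun t) := by
  refine (u.edist_le_cost v (OrderIso.refl _)).trans (le_of_eq ?_)
  simp [Skorokhod.cost, Skorokhod.distortion_refl]

lemma tendsto_two_div_two_pow :
    Tendsto (fun n : ℕ => (2 : ℝ≥0∞) * 1 / 2 ^ n) atTop (𝓝 0) := by
  have := ENNReal.Tendsto.const_mul (a := 2) (ENNReal.tendsto_pow_atTop_nhds_zero_of_lt_one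
    (r := 2⁻¹) (by norm_num)) (Or.inr ENNReal.ofNat_ne_top)
  simpa [div_eq_mul_inv, ENNReal.inv_pow] using this

open Skorokhod in
/-- Time changes whose successive displacements and distortions are summable converge uniformly
to a time change. -/
lemma exists_limit_orderIso (l L : ℕ → (Icc (0 : ℝ) T ≃o Icc (0 : ℝ) T))
    (hL : ∀ n, L (n + 1) = (L n).trans (l n))
    (hdisp : ∀ n t, edist t (l n t) ≤ 1 / 2 ^ n)
    (hdist : ∀ n, distortion (l n) ≤ 1 / 2 ^ n) :
    ∃ F : Icc (0 : ℝ) T ≃o Icc (0 : ℝ) T, ∀ n, (∀ t, edist (L n t) (F t) ≤ 2 * 1 / 2 ^ n) ∧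
      distortion ((L n).symm.trans F) ≤ ENNReal.ofReal (2 / 2 ^ n) := by
  have hstep : ∀ n t, edist (L n t) (L (n + 1) t) ≤ 1 / 2 ^ n := fun n t => by
    rw [hL]; exact hdisp n (L n t)
  have hlim : ∀ t, ∃ a, Tendsto (fun n => L n t) atTop (𝓝 a) := fun t =>
    cauchySeq_tendsto_of_complete
      (cauchySeq_of_edist_le_geometric_two 1 ENNReal.one_ne_top fun n => hstep n t)
  choose f hf using hlim
  have hdistM : ∀ n k, distortion ((L n).symm.trans (L (n + k))) + 2 / 2 ^ (n + k)
      ≤ 2 / 2 ^ n := by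
    intro n k
    induction k with
    | zero =>
      have : (L n).symm.trans (L (n + 0)) = OrderIso.refl _ := OrderIso.symm_trans_self _
      rw [this, distortion_refl, zero_add, add_zero]
    | succ k ih =>
      have e : (L n).symm.trans (L (n + (k + 1)))
          = ((L n).symm.trans (L (n + k))).trans (l (n + k)) := by
        rw [← add_assoc, hL]; rfl
      refine le_trans ?_ ih
      rw [e]
      refine (add_le_add_left (distortion_trans_le _ _) _).trans ?_
      rw [add_assoc]
      refine add_le_add_right ?_ _
      have e₁ : (2 : ℝ≥0∞) / 2 ^ (n + (k + 1)) = 1 / 2 ^ (n + k) := by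
        rw [← add_assoc, pow_succ, mul_comm]
        simpa using ENNReal.mul_div_mul_left 1 (2 ^ (n + k)) two_ne_zero ENNReal.ofNat_ne_top
      rw [e₁]
      refine (add_le_add_left (hdist _) _).trans (le_of_eq ?_)
      rw [← ENNReal.add_div]
      norm_num
  have hslope : ∀ n (s t : Icc (0 : ℝ) T), s ≤ t →
      Real.exp (-(2 / 2 ^ n)) * ((L n t : ℝ) - L n s) ≤ (f t : ℝ) - f s ∧
      (f t : ℝ) - f s ≤ Real.exp (2 / 2 ^ n) * ((L n t : ℝ) - L n s) := by
    intro n s t hst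
    have hd : ∀ k, distortion ((L n).symm.trans (L (n + k))) ≤ ENNReal.ofReal (2 / 2 ^ n) := by
      intro k
      refine (le_self_add.trans (hdistM n k)).trans (le_of_eq ?_)
      rw [ENNReal.ofReal_div_of_pos (by positivity), ENNReal.ofReal_pow (by norm_num)]
      norm_num
    have hk : ∀ k, Real.exp (-(2 / 2 ^ n)) * ((L n t : ℝ) - L n s) ≤ (L (n + k) t : ℝ) - L (n + k) s
      ∧ (L (n + k) t : ℝ) - L (n + k) s ≤ Real.exp (2 / 2 ^ n) * ((L n t : ℝ) - L n s) := by
      intro k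
      have := slopes_of_distortion_le _ (by positivity) (hd k) ((L n).monotone hst)
      simpa using this
    have hc : Tendsto (fun k => (L (n + k) t : ℝ) - L (n + k) s) atTop (𝓝 ((f t : ℝ) - f s)) := by
      have h₁ : ∀ t, Tendsto (fun k => (L (n + k) t : ℝ)) atTop (𝓝 (f t)) := fun t =>
        ((continuous_subtype_val.tendsto _).comp (hf t)).comp
          (tendsto_atTop_mono (fun k => Nat.le_add_left k n) tendsto_id)
      exact (h₁ t).sub (h₁ s)
    exact ⟨ge_of_tendsto' hc fun k => (hk k).1, le_of_tendsto' hc fun k => (hk k).2⟩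
  have hsm : StrictMono f := by
    intro s t hst
    have h₁ := (hslope 0 s t hst.le).1
    have h₂ : (0 : ℝ) < (L 0 t : ℝ) - L 0 s := sub_pos.2 ((L 0).strictMono hst)
    have := mul_pos (Real.exp_pos (-(2 / 2 ^ 0))) h₂
    exact Subtype.coe_lt_coe.1 (by linarith)
  have hsurj : Function.Surjective f := by
    have hunif : TendstoUniformly (fun n t => L n t) f atTop := by
      refine EMetric.tendstoUniformly_iff.2 fun ε hε => ?_
      filter_upwards [tendsto_two_div_two_pow.eventually_lt_const hε] with n hn t
      rw [edist_comm]
      exact (edist_le_of_edist_le_geometric_two_of_tendsto 1 (fun n => hstep n t) (hf t) n).trans_lt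
        hn
    have hcont : Continuous f :=
      hunif.continuous (Frequently.of_forall fun n => (L n).continuous)
    have : PreconnectedSpace (Icc (0 : ℝ) T) := Subtype.preconnectedSpace isPreconnected_Icc
    intro c
    have h0T : (0 : ℝ) ≤ T := c.2.1.trans c.2.2
    refine mem_range_of_exists_le_of_exists_ge hcont
      ⟨⟨0, le_rfl, h0T⟩, le_of_tendsto' (hf _) fun n => ?_⟩
      ⟨⟨T, h0T, le_rfl⟩, ge_of_tendsto' (hf _) fun n => ?_⟩
    · calc L n ⟨0, le_rfl, h0T⟩ ≤ L n ((L n).symm c) := (L n).monotone ((L n).symm c).2.1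
        _ = c := (L n).apply_symm_apply c
    · calc c = L n ((L n).symm c) := ((L n).apply_symm_apply c).symm
        _ ≤ L n ⟨T, h0T, le_rfl⟩ := (L n).monotone ((L n).symm c).2.2
  let F := hsm.orderIsoOfSurjective f hsurj
  have hF : ∀ t, F t = f t := fun t => rfl
  refine ⟨F, fun n => ⟨fun t => ?_, ?_⟩⟩
  · exact edist_le_of_edist_le_geometric_two_of_tendsto 1 (fun n => hstep n t) (hf t) n
  · refine distortion_le_of_slopes _ fun s t hst => ?_
    have : _ ∧ _ := hslope n ((L n).symm s) ((L n).symm t) ((L n).symm.monotone hst.le)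
    rwa [(L n).apply_symm_apply, (L n).apply_symm_apply] at this

open Skorokhod in
/-- The Skorokhod metric of a complete space is complete. For a rapidly Cauchy sequence `u n`, the
time changes `l n` that bring `u n` close to `u (n + 1)` are composed to `L n`; then `u n ∘ L n`
converges uniformly, to `w`, and the `L n` converge, to `F`, so that `u n` tends to `w ∘ F⁻¹`. -/
instance CadlagPath.instCompleteSpace [PseudoMetricSpace S] [CompleteSpace S] :
    CompleteSpace (CadlagPath T S) := by
  refine EMetric.complete_of_convergent_controlled_sequences (fun n => 1 / 2 ^ n)
    (fun n => ENNReal.div_pos one_ne_zero (by simp)) fun u hu => ?_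
  choose l hl using fun n => CadlagPath.exists_cost_lt (hu n n (n + 1) le_rfl n.le_succ)
  let L : ℕ → (Icc (0 : ℝ) T ≃o Icc (0 : ℝ) T) := fun n =>
    Nat.rec (OrderIso.refl _) (fun n m => m.trans (l n)) n
  have hL : ∀ n, L (n + 1) = (L n).trans (l n) := fun n => rfl
  have hcost : ∀ n, (⨆ t, edist ((u n).toFun t) ((u (n + 1)).toFun (l n t))) ≤ 1 / 2 ^ n ∧
      (⨆ t, edist t (l n t)) ≤ 1 / 2 ^ n ∧ distortion (l n) ≤ 1 / 2 ^ n := fun n =>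
    ⟨(le_self_add.trans le_self_add).trans (hl n).le,
      (le_add_self.trans le_self_add).trans (hl n).le, le_add_self.trans (hl n).le⟩
  obtain ⟨F, hF⟩ := exists_limit_orderIso l L hL
    (fun n t => (le_iSup (fun t => edist t (l n t)) t).trans (hcost n).2.1) fun n => (hcost n).2.2
  have hstep : ∀ n t, edist ((u n).toFun (L n t)) ((u (n + 1)).toFun (L (n + 1) t)) ≤ 1 / 2 ^ n :=
    fun n t => (le_iSup (fun t => edist ((u n).toFun t) ((u (n + 1)).toFun (l n t)))
      (L n t)).trans (hcost n).1
  have hlim : ∀ t, ∃ a, Tendsto (fun n => (u n).toFun (L n t)) atTop (𝓝 a) := fun t =>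
    cauchySeq_tendsto_of_complete
      (cauchySeq_of_edist_le_geometric_two 1 ENNReal.one_ne_top fun n => hstep n t)
  choose w hw using hlim
  have hwd : ∀ n t, edist ((u n).toFun (L n t)) (w t) ≤ 2 * 1 / 2 ^ n := fun n t =>
    edist_le_of_edist_le_geometric_two_of_tendsto 1 (fun n => hstep n t) (hw t) n
  have hwc : IsCadlag w := by
    refine isCadlag_of_approx fun ε hε => ?_
    obtain ⟨n, hn⟩ := (tendsto_two_div_two_pow.eventually_lt_const (ENNReal.ofReal_pos.2 hε)).exists
    refine ⟨fun t => (u n).toFun (L n t), (u n).isCadlag.comp_orderIso (L n), fun t => ?_⟩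
    have := (hwd n t).trans hn.le
    rwa [edist_comm, edist_dist, ENNReal.ofReal_le_ofReal_iff hε.le] at this
  refine ⟨⟨fun t => w (F.symm t), hwc.comp_orderIso F.symm⟩, ?_⟩
  rw [EMetric.tendsto_nhds]
  have h₁ : Tendsto (fun n : ℕ => (2 : ℝ≥0∞) * 1 / 2 ^ n + 2 * 1 / 2 ^ n + 2 * 1 / 2 ^ n) atTop
      (𝓝 0) := by
    simpa using (tendsto_two_div_two_pow.add tendsto_two_div_two_pow).add
      tendsto_two_div_two_pow
  intro ε hε
  filter_upwards [h₁.eventually_lt_const hε] with n hn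
  refine (CadlagPath.edist_le_cost _ _ ((L n).symm.trans F)).trans_lt (lt_of_le_of_lt ?_ hn)
  refine add_le_add (add_le_add (iSup_le fun t => ?_) (iSup_le fun t => ?_)) ?_
  · have := hwd n ((L n).symm t)
    rw [(L n).apply_symm_apply] at this
    simpa using this
  · have := (hF n).1 ((L n).symm t)
    rwa [(L n).apply_symm_apply] at this
  · refine (hF n).2.trans (le_of_eq ?_)
    rw [ENNReal.ofReal_div_of_pos (by positivity), ENNReal.ofReal_pow (by norm_num)]
    norm_num

end Complete

/-! ### Oscillation along partitions -/

section Oscillation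

variable {T : ℝ} {S : Type*} [PseudoMetricSpace S]

/-- `u` oscillates by at most `ε` on each interval `[a, b)` cut out by the points of `D`. The
intervals are described through their points: `s` and `t` lie in the same one if the same
points of `D` precede them. -/
def OscillatesAtMost (u : Icc (0 : ℝ) T → S) (D : Set (Icc (0 : ℝ) T)) (ε : ℝ) : Prop :=
  ∀ s t, (∀ a ∈ D, a ≤ s ↔ a ≤ t) → dist (u s) (u t) ≤ ε

/-- `[0,T]` has a partition with mesh at least `δ` such that `u` oscillates by at most `ε` on
each of its half-open intervals; in terms of the càdlàg modulus, `w'(u, δ) ≤ ε`. -/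
def HasOscPartition (u : Icc (0 : ℝ) T → S) (δ ε : ℝ) : Prop :=
  ∃ D : Set (Icc (0 : ℝ) T), (∀ t : Icc (0 : ℝ) T, (t : ℝ) = 0 ∨ (t : ℝ) = T → t ∈ D) ∧
    (∀ a ∈ D, ∀ b ∈ D, a ≠ b → δ ≤ |(a : ℝ) - b|) ∧ OscillatesAtMost u D ε

/-- One-sided limits bound the oscillation near a point, on each side of it separately. -/
lemma IsCadlag.exists_local_osc {u : Icc (0 : ℝ) T → S} (hu : IsCadlag u) (t : Icc (0 : ℝ) T)
    {ε : ℝ} (hε : 0 < ε) :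
    ∃ r : ℝ, 0 < r ∧ ∀ s ∈ Metric.ball t r, ∀ s' ∈ Metric.ball t r, (t ≤ s ↔ t ≤ s') →
      dist (u s) (u s') ≤ ε := by
  obtain ⟨l, hl⟩ := (hu t).2
  have h₁ := Metric.tendsto_nhds.1 (hu t).1 (ε / 2) (by positivity)
  have h₂ := Metric.tendsto_nhds.1 hl (ε / 2) (by positivity)
  obtain ⟨r₁, hr₁, h₁⟩ := Metric.mem_nhdsWithin_iff.1 h₁
  obtain ⟨r₂, hr₂, h₂⟩ := Metric.mem_nhdsWithin_iff.1 h₂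
  refine ⟨min r₁ r₂, lt_min hr₁ hr₂, fun s hs s' hs' hiff => ?_⟩
  by_cases hts : t ≤ s
  · have a₁ : dist (u s) (u t) < ε / 2 := h₁ ⟨Metric.ball_subset_ball (min_le_left _ _) hs, hts⟩
    have a₂ : dist (u s') (u t) < ε / 2 :=
      h₁ ⟨Metric.ball_subset_ball (min_le_left _ _) hs', hiff.1 hts⟩
    have := dist_triangle_right (u s) (u s') (u t)
    linarith
  · have a₁ : dist (u s) l < ε / 2 :=
      h₂ ⟨Metric.ball_subset_ball (min_le_right _ _) hs, not_le.1 hts⟩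
    have a₂ : dist (u s') l < ε / 2 :=
      h₂ ⟨Metric.ball_subset_ball (min_le_right _ _) hs', not_le.1 fun h => hts (hiff.2 h)⟩
    have := dist_triangle_right (u s) (u s') l
    linarith

lemma IsCadlag.exists_finite_osc {u : Icc (0 : ℝ) T → S} (hu : IsCadlag u) {ε : ℝ}
    (hε : 0 < ε) : ∃ D : Set (Icc (0 : ℝ) T), D.Finite ∧ OscillatesAtMost u D ε := by
  choose r hr hosc using fun t => hu.exists_local_osc t hε
  obtain ⟨F, hF⟩ := finite_cover_nhds fun t => Metric.ball_mem_nhds t (hr t)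
  let e : Icc (0 : ℝ) T → Icc (0 : ℝ) T := fun t => projIcc 0 T (t.2.1.trans t.2.2) (t + r t)
  refine ⟨F ∪ e '' F, F.finite_toSet.union (F.finite_toSet.image e), ?_⟩
  have key : ∀ s s', s ≤ s' → (∀ a ∈ (F ∪ e '' F : Set _), a ≤ s ↔ a ≤ s') →
      dist (u s) (u s') ≤ ε := by
    intro s s' hss hiff
    obtain ⟨t, htF, hst⟩ : ∃ t ∈ F, s ∈ Metric.ball t (r t) := by
      have : s ∈ ⋃ x ∈ F, Metric.ball x (r x) := hF ▸ mem_univ s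
      simpa using this
    refine hosc t s hst s' ?_ (hiff t (Or.inl htF))
    rw [Metric.mem_ball, Subtype.dist_eq, Real.dist_eq, abs_lt] at hst ⊢
    refine ⟨by have : (s : ℝ) ≤ s' := hss; linarith [hst.1], ?_⟩
    -- a point beyond the right end of the ball would be separated from `s` by that end
    by_contra! hge
    have hT : (t : ℝ) + r t ≤ T := by linarith [s'.2.2]
    have he : (e t : ℝ) = t + r t := by
      simp only [e]
      rw [projIcc_of_mem _ (⟨by linarith [t.2.1, hr t], hT⟩ : (t : ℝ) + r t ∈ Icc (0 : ℝ) T)]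
    have h₁ : e t ≤ s := (hiff (e t) (Or.inr ⟨t, htF, rfl⟩)).2
      (Subtype.coe_le_coe.1 (by rw [he]; linarith))
    have h₂ : (e t : ℝ) ≤ s := h₁
    rw [he] at h₂
    linarith [hst.2]
  intro s t hiff
  rcases le_total s t with h | h
  · exact key s t h hiff
  · rw [dist_comm]
    exact key t s h fun a ha => (hiff a ha).symm

lemma IsCadlag.exists_hasOscPartition {u : Icc (0 : ℝ) T → S} (hu : IsCadlag u) {ε : ℝ}
    (hε : 0 < ε) : ∃ δ : ℝ, 0 < δ ∧ HasOscPartition u δ ε := by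
  obtain ⟨D, hD, hosc⟩ := hu.exists_finite_osc hε
  have hE : {t : Icc (0 : ℝ) T | (t : ℝ) = 0 ∨ (t : ℝ) = T}.Finite :=
    ((Set.toFinite {(0 : ℝ), T}).preimage Subtype.val_injective.injOn).subset fun t ht => ht
  obtain ⟨C, hC, hsep⟩ := einfsep_pos.1 (hD.union hE).einfsep_pos
  refine ⟨(min C 1).toReal, ENNReal.toReal_pos (lt_min hC one_pos).ne'
    (ne_top_of_le_ne_top ENNReal.one_ne_top (min_le_right _ _)), _, fun t ht => Or.inr ht,
    fun a ha b hb hab => ?_, fun s t h => hosc s t fun a ha => h a (Or.inl ha)⟩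
  have := (min_le_left C 1).trans (hsep a ha b hb hab)
  rw [edist_dist] at this
  have := ENNReal.toReal_le_of_le_ofReal dist_nonneg this
  rwa [Subtype.dist_eq, Real.dist_eq] at this

/-- A càdlàg function is continuous off a countable set. -/
lemma IsCadlag.countable_not_continuousAt {u : Icc (0 : ℝ) T → S} (hu : IsCadlag u) :
    {t | ¬ ContinuousAt u t}.Countable := by
  choose D hD hosc using fun n : ℕ =>
    hu.exists_finite_osc (Nat.one_div_pos_of_nat (α := ℝ) (n := n))
  refine (countable_iUnion fun n => (hD n).countable).mono fun t ht => ?_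
  by_contra hmem
  refine ht (Metric.tendsto_nhds.2 fun ε hε => ?_)
  obtain ⟨n, hn⟩ := exists_nat_one_div_lt hε
  -- near a point outside the finite set `D n`, no two points are separated by `D n`
  have hev : ∀ᶠ s in 𝓝 t, ∀ a ∈ D n, a ≤ s ↔ a ≤ t := by
    refine (hD n).eventually_all.2 fun a ha => ?_
    have hat : a ≠ t := fun h => hmem (mem_iUnion.2 ⟨n, h ▸ ha⟩)
    rcases hat.lt_or_gt with h | h
    · filter_upwards [lt_mem_nhds h] with s hs
      exact iff_of_true hs.le h.le
    · filter_upwards [gt_mem_nhds h] with s hs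
      exact iff_of_false (not_le.2 hs) (not_le.2 h)
  filter_upwards [hev] with s hs
  exact (hosc n s t hs).trans_lt hn

end Oscillation

/-! ### Discretization along equidistant grids -/

section Grid

variable {T : ℝ} {S : Type*}

/-- The index of the last point of the grid `{i T / N}` that is `≤ t`. -/
def gridIndex (N : ℕ) (t : Icc (0 : ℝ) T) : ℕ := ⌊(N : ℝ) / T * t⌋₊

lemma gridIndex_lt (N : ℕ) (t : Icc (0 : ℝ) T) : gridIndex N t < N + 1 := by
  refine Nat.lt_succ_of_le (Nat.floor_le_of_le ?_)
  rw [div_mul_eq_mul_div, mul_div_assoc]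
  exact mul_le_of_le_one_right (Nat.cast_nonneg _)
    (div_le_one_of_le₀ t.2.2 (t.2.1.trans t.2.2))

/-- The grid point `i T / N`, for `i ≤ N`. -/
def gridPoint (hT : 0 < T) (N i : ℕ) : Icc (0 : ℝ) T := projIcc 0 T hT.le (T * i / N)

lemma coe_gridPoint (hT : 0 < T) {N i : ℕ} (hi : i ≤ N) :
    (gridPoint hT N i : ℝ) = T * i / N := by
  rw [gridPoint, projIcc_of_mem]
  refine ⟨by positivity, ?_⟩
  rw [mul_div_assoc]
  exact mul_le_of_le_one_right hT.le (div_le_one_of_le₀ (Nat.cast_le.2 hi) (Nat.cast_nonneg _))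

lemma le_gridIndex_iff (hT : 0 < T) {N : ℕ} (hN : 0 < N) (t : Icc (0 : ℝ) T) (i : ℕ) :
    i ≤ gridIndex N t ↔ T * i / N ≤ t := by
  have hN' : (0 : ℝ) < N := Nat.cast_pos.2 hN
  rw [gridIndex, Nat.le_floor_iff (mul_nonneg (by positivity) t.2.1), div_mul_eq_mul_div,
    le_div_iff₀ hT, div_le_iff₀ hN', mul_comm, mul_comm (N : ℝ)]

lemma gridIndex_gridPoint (hT : 0 < T) {N i k : ℕ} (hN : 0 < N) (hk : 0 < k) (hi : i ≤ N) :
    gridIndex (N * k) (gridPoint hT N i) = i * k := by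
  have hN' : (N : ℝ) ≠ 0 := Nat.cast_ne_zero.2 hN.ne'
  rw [gridIndex, coe_gridPoint hT hi, ← Nat.floor_natCast (R := ℝ) (i * k)]
  congr 1
  push_cast
  field_simp

/-- The càdlàg step function with value `x i` on `[i T / N, (i + 1) T / N)`. -/
def stepPath [TopologicalSpace S] {N : ℕ} (x : Fin (N + 1) → S) : CadlagPath T S where
  toFun t := x ⟨gridIndex N t, gridIndex_lt N t⟩
  isCadlag := by
    rcases lt_or_ge T 0 with hT | hT
    · exact fun t => absurd (t.2.1.trans t.2.2) hT.not_ge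
    have h : (fun t : Icc (0 : ℝ) T => x ⟨gridIndex N t, gridIndex_lt N t⟩)
        = fun t : Icc (0 : ℝ) T =>
          (fun i : ℤ => x ⟨min i.toNat N, by omega⟩) ⌊(N : ℝ) / T * t⌋ := by
      funext t
      have : gridIndex N t ≤ N := Nat.lt_succ_iff.1 (gridIndex_lt N t)
      simp only [Int.floor_toNat]
      congr 2
      exact (min_eq_left this).symm
    rw [h]
    exact isCadlag_comp_floor (fun i : ℤ => x ⟨min i.toNat N, by omega⟩)
      (div_nonneg (Nat.cast_nonneg N) hT)

lemma lipschitzWith_stepPath [PseudoEMetricSpace S] {N : ℕ} :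
    LipschitzWith 1 (stepPath : (Fin (N + 1) → S) → CadlagPath T S) := fun x y => by
  rw [ENNReal.coe_one, one_mul]
  exact (CadlagPath.edist_le_iSup _ _).trans (iSup_le fun t => edist_le_pi_edist x y _)

/-- The step function that agrees with `u` on the grid `{i T / N}`. -/
def discretize [TopologicalSpace S] (hT : 0 < T) (N : ℕ) (u : Icc (0 : ℝ) T → S) :
    CadlagPath T S := stepPath fun i : Fin (N + 1) => u (gridPoint hT N i)

lemma discretize_apply [TopologicalSpace S] (hT : 0 < T) (N : ℕ) (u : Icc (0 : ℝ) T → S)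
    (t : Icc (0 : ℝ) T) : (discretize hT N u).toFun t = u (gridPoint hT N (gridIndex N t)) := rfl

lemma gridPoint_mul (hT : 0 < T) {N i k : ℕ} (hk : 0 < k) :
    gridPoint hT (N * k) (i * k) = gridPoint hT N i := by
  have hk' : (k : ℝ) ≠ 0 := Nat.cast_ne_zero.2 hk.ne'
  rw [gridPoint, gridPoint]
  congr 1
  push_cast
  rw [← mul_assoc, mul_div_mul_right _ _ hk']

lemma discretize_discretize [TopologicalSpace S] (hT : 0 < T) {N k : ℕ} (hN : 0 < N) (hk : 0 < k)
    (u : Icc (0 : ℝ) T → S) :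
    discretize hT N (discretize hT (N * k) u).toFun = discretize hT N u := by
  have h : ∀ t : Icc (0 : ℝ) T, (discretize hT N (discretize hT (N * k) u).toFun).toFun t
      = (discretize hT N u).toFun t := fun t => by
    rw [discretize_apply, discretize_apply, discretize_apply,
      gridIndex_gridPoint hT hN hk (Nat.lt_succ_iff.1 (gridIndex_lt N t)), gridPoint_mul hT hk]
  rw [CadlagPath.mk.injEq]
  exact funext h

/-- If `u` oscillates little along a partition with mesh `δ`, then moving the points of the
partition up to the next points of a fine grid is a time change close to the identity which
brings `u` close to its discretization. -/
lemma edist_discretize_le [PseudoMetricSpace S] (hT : 0 < T) {u : CadlagPath T S} {δ ε : ℝ}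
    (hδ : 0 < δ) (hu : HasOscPartition u.toFun δ ε) {N : ℕ} (hN : 0 < N)
    (hNδ : T / (N * δ) ≤ 1 / 2) :
    edist u (discretize hT N u.toFun) ≤ ENNReal.ofReal ε + ENNReal.ofReal (T / (N * δ) * T)
      + ENNReal.ofReal (2 * (T / (N * δ))) := by
  obtain ⟨D, hend, hsep, hosc⟩ := hu
  have hN' : (0 : ℝ) < N := Nat.cast_pos.2 hN
  let g : ℝ → ℝ := fun s => T * ⌈(N : ℝ) / T * s⌉₊ / N - s
  have hg : ∀ s, 0 ≤ s → 0 ≤ g s ∧ g s ≤ T / N := by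
    intro s hs
    have h₁ := Nat.le_ceil ((N : ℝ) / T * s)
    have h₂ := (Nat.ceil_lt_add_one (show 0 ≤ (N : ℝ) / T * s by positivity)).le
    have e : T * ((N : ℝ) / T * s) / N = s := by field_simp
    constructor
    · rw [sub_nonneg]
      calc s = T * ((N : ℝ) / T * s) / N := e.symm
        _ ≤ _ := div_le_div_of_nonneg_right (mul_le_mul_of_nonneg_left h₁ hT.le) hN'.le
    · rw [sub_le_iff_le_add]
      calc T * (⌈(N : ℝ) / T * s⌉₊ : ℝ) / N ≤ T * ((N : ℝ) / T * s + 1) / N :=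
            div_le_div_of_nonneg_right (mul_le_mul_of_nonneg_left h₂ hT.le) hN'.le
        _ = T / N + s := by field_simp; ring
  let K : ℝ≥0 := ⟨T / (N * δ), by positivity⟩
  have hlip : LipschitzOnWith K g (Subtype.val '' D) := by
    rw [lipschitzOnWith_iff_dist_le_mul]
    rintro _ ⟨a, ha, rfl⟩ _ ⟨b, hb, rfl⟩
    rcases eq_or_ne a b with rfl | hab
    · simp
    have h₁ := hg a a.2.1
    have h₂ := hg b b.2.1
    rw [Real.dist_eq, Real.dist_eq]
    calc |g a - g b| ≤ T / N := abs_le.2 ⟨by linarith, by linarith⟩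
      _ = T / (N * δ) * δ := by field_simp
      _ ≤ T / (N * δ) * |(a : ℝ) - b| :=
        mul_le_mul_of_nonneg_left (hsep a ha b hb hab) (by positivity)
  -- the displacements of the points of `D`, extended to a Lipschitz function on the line
  obtain ⟨φ, hφ, hφg⟩ := hlip.extend_real
  have hφ0 : φ 0 = 0 := by
    rw [← hφg ⟨⟨0, le_rfl, hT.le⟩, hend _ (Or.inl rfl), rfl⟩]
    simp [g]
  have hφT : φ T = 0 := by
    rw [← hφg ⟨⟨T, hT.le, le_rfl⟩, hend _ (Or.inr rfl), rfl⟩]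
    have : (N : ℝ) / T * T = N := by field_simp
    simp only [g]
    rw [this, Nat.ceil_natCast]
    field_simp
    ring
  obtain ⟨l, hl, hl₁, hl₂⟩ :=
    Skorokhod.exists_orderIso_of_lipschitz (T := T) (K := K) hNδ hφ hφ0 hφT
  refine (u.edist_le_cost _ l).trans (add_le_add (add_le_add (iSup_le fun t => ?_) hl₁) hl₂)
  rw [edist_dist, discretize_apply]
  refine ENNReal.ofReal_le_ofReal (hosc _ _ fun a ha => ?_)
  -- `l a` is the first grid point above `a`
  have hla : (l a : ℝ) = T * ⌈(N : ℝ) / T * a⌉₊ / N := by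
    rw [hl, ← hφg ⟨a, ha, rfl⟩]
    exact add_sub_cancel _ _
  rw [← l.le_iff_le, ← Subtype.coe_le_coe, hla, ← le_gridIndex_iff hT hN, Nat.ceil_le,
    ← Subtype.coe_le_coe, coe_gridPoint hT (Nat.lt_succ_iff.1 (gridIndex_lt N _)),
    le_div_iff₀ hN', div_mul_eq_mul_div, div_le_iff₀ hT, mul_comm (N : ℝ), mul_comm T]

/-- The bound of `edist_discretize_le` tends to `ε` as the grid is refined. -/
lemma exists_forall_edist_discretize_le (hT : 0 < T) {δ ε ε' : ℝ} (hδ : 0 < δ) (hε : 0 ≤ ε)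
    (hεε' : ε < ε') :
    ∃ N₀ : ℕ, 0 < N₀ ∧ ∀ (S : Type*) [PseudoMetricSpace S] (u : CadlagPath T S),
      HasOscPartition u.toFun δ ε → ∀ N, N₀ ≤ N →
        edist u (discretize hT N u.toFun) ≤ ENNReal.ofReal ε' := by
  have h₀ : Tendsto (fun N : ℕ => T / (N * δ)) atTop (𝓝 0) := by
    have := tendsto_const_div_atTop_nhds_zero_nat (T / δ)
    refine this.congr fun N => ?_
    rw [div_div, mul_comm]
  have h₁ : Tendsto (fun N : ℕ => ε + T / (N * δ) * T + 2 * (T / (N * δ))) atTop (𝓝 ε) := by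
    simpa using ((h₀.mul_const T).const_add ε).add (h₀.const_mul 2)
  obtain ⟨N₀, hN₀⟩ := eventually_atTop.1 ((h₁.eventually_le_const hεε').and
    (h₀.eventually_le_const one_half_pos))
  refine ⟨N₀ + 1, N₀.succ_pos, fun S _ u hu N hN => ?_⟩
  have hNpos : 0 < N := N₀.succ_pos.trans_le hN
  refine (edist_discretize_le hT hδ hu hNpos (hN₀ N (Nat.le_of_succ_le hN)).2).trans ?_
  rw [← ENNReal.ofReal_add hε (by positivity), ← ENNReal.ofReal_add (by positivity) (by positivity)]
  exact ENNReal.ofReal_le_ofReal (hN₀ N (Nat.le_of_succ_le hN)).1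

lemma tendsto_discretize [PseudoMetricSpace S] (hT : 0 < T) (u : CadlagPath T S) :
    Tendsto (fun N => discretize hT N u.toFun) atTop (𝓝 u) := by
  refine EMetric.tendsto_nhds.2 fun ε hε => ?_
  obtain ⟨ε', hε', hlt⟩ := exists_between hε
  obtain ⟨r, hr, hrε⟩ := ENNReal.lt_iff_exists_real_btwn.1 hε'
  have hr0 : 0 < r := ENNReal.ofReal_pos.1 hrε.1
  obtain ⟨δ, hδ, hosc⟩ := u.isCadlag.exists_hasOscPartition (half_pos hr0)
  obtain ⟨N₀, -, hN₀⟩ := exists_forall_edist_discretize_le hT hδ (half_pos hr0).le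
    (half_lt_self hr0)
  filter_upwards [eventually_ge_atTop N₀] with N hN
  rw [edist_comm]
  exact (hN₀ S u hosc N hN).trans_lt (hrε.2.trans hlt)

/-- A family of paths with values in a compact set that are approximated by their discretizations,
uniformly over the family, is relatively compact. -/
lemma isCompact_closure_of_discretize [PseudoMetricSpace S] [CompleteSpace S] (hT : 0 < T)
    {L : Set S} (hL : IsCompact L) {𝒦 : Set (CadlagPath T S)} (hval : ∀ u ∈ 𝒦, ∀ t, u.toFun t ∈ L)
    (N : ℕ → ℕ) (happ : ∀ u ∈ 𝒦, ∀ k : ℕ,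
      edist u (discretize hT (N k) u.toFun) ≤ ENNReal.ofReal (1 / (k + 1))) :
    IsCompact (closure 𝒦) := by
  refine TotallyBounded.isCompact_of_isClosed (TotallyBounded.closure ?_) isClosed_closure
  refine EMetric.totallyBounded_iff.2 fun ε hε => ?_
  obtain ⟨k, hk⟩ : ∃ k : ℕ, ENNReal.ofReal (1 / (k + 1)) < ε / 2 := by
    have : Tendsto (fun k : ℕ => ENNReal.ofReal (1 / (k + 1))) atTop (𝓝 0) := by
      simpa using ENNReal.tendsto_ofReal (tendsto_one_div_add_atTop_nhds_zero_nat (𝕜 := ℝ))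
    exact (this.eventually_lt_const (ENNReal.half_pos hε.ne')).exists
  have hc : IsCompact ((stepPath : (Fin (N k + 1) → S) → CadlagPath T S) ''
      (Set.univ.pi fun _ => L)) :=
    (isCompact_univ_pi fun _ => hL).image lipschitzWith_stepPath.continuous
  obtain ⟨F, hF, hcover⟩ := EMetric.totallyBounded_iff.1 hc.totallyBounded (ε / 2)
    (ENNReal.half_pos hε.ne')
  refine ⟨F, hF, fun u hu => ?_⟩
  obtain ⟨y, hy, hyu⟩ : ∃ y ∈ F, edist (discretize hT (N k) u.toFun) y < ε / 2 := by
    have := hcover ⟨_, fun i _ => hval u hu (gridPoint hT (N k) i), rfl⟩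
    simpa [discretize] using this
  refine mem_iUnion₂.2 ⟨y, hy, ?_⟩
  calc edist u y ≤ edist u (discretize hT (N k) u.toFun) + edist (discretize hT (N k) u.toFun) y :=
        edist_triangle _ _ _
    _ < ε / 2 + ε / 2 := ENNReal.add_lt_add ((happ u hu k).trans_lt hk) hyu
    _ = ε := ENNReal.add_halves ε

lemma stronglyMeasurable_finite_pi {Ω ι : Type*} [Finite ι] {mΩ : MeasurableSpace Ω}
    [TopologicalSpace S] {f : Ω → ι → S} (hf : ∀ i, StronglyMeasurable fun ω => f ω i) :
    StronglyMeasurable f := by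
  let g : ℕ → SimpleFunc Ω (ι → S) := fun n =>
    { toFun := fun ω i => (hf i).approx n ω
      measurableSet_fiber' := fun x => by
        have : (fun ω i => (hf i).approx n ω) ⁻¹' {x}
            = ⋂ i, (hf i).approx n ⁻¹' {x i} := by
          ext ω
          simp [funext_iff]
        rw [this]
        exact MeasurableSet.iInter fun i => SimpleFunc.measurableSet_fiber _ _
      finite_range' := by
        refine (Set.Finite.pi' fun i => ((hf i).approx n).finite_range).subset ?_
        rintro _ ⟨ω, rfl⟩ i
        exact mem_range_self ω }
  exact ⟨g, fun ω => tendsto_pi_nhds.2 fun i => (hf i).tendsto_approx ω⟩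

/-- A random càdlàg path is a random element of the Skorokhod space as soon as its coordinates are
measurable, because it is the limit of its discretizations. -/
lemma stronglyMeasurable_cadlagPath [PseudoMetricSpace S] (hT : 0 < T) {Ω : Type*}
    {mΩ : MeasurableSpace Ω} {W : Ω → CadlagPath T S}
    (hW : ∀ t, StronglyMeasurable fun ω => (W ω).toFun t) : StronglyMeasurable W := by
  refine stronglyMeasurable_of_tendsto atTop (f := fun N ω => discretize hT N (W ω).toFun)
    (fun N => ?_) (tendsto_pi_nhds.2 fun ω => tendsto_discretize hT (W ω))
  exact lipschitzWith_stepPath.continuous.comp_stronglyMeasurable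
    (stronglyMeasurable_finite_pi fun i => hW (gridPoint hT N i))

/-- The points of a sequence of grids that approach `t` from the right. -/
def gridAbove (hT : 0 < T) (N : ℕ) (t : Icc (0 : ℝ) T) : Icc (0 : ℝ) T :=
  gridPoint hT (N + 1) ⌈((N + 1 : ℕ) : ℝ) / T * t⌉₊

lemma tendsto_gridAbove (hT : 0 < T) (t : Icc (0 : ℝ) T) :
    Tendsto (fun N => gridAbove hT N t) atTop (𝓝[≥] t) := by
  have hval : ∀ N : ℕ, (gridAbove hT N t : ℝ)
      = T * ⌈((N + 1 : ℕ) : ℝ) / T * t⌉₊ / (N + 1 : ℕ) := fun N => by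
    refine coe_gridPoint hT (Nat.ceil_le.2 ?_)
    rw [div_mul_eq_mul_div, mul_div_assoc]
    exact mul_le_of_le_one_right (Nat.cast_nonneg _) (div_le_one_of_le₀ t.2.2 hT.le)
  have hle : ∀ N : ℕ, (t : ℝ) ≤ gridAbove hT N t := fun N => by
    rw [hval, le_div_iff₀ (by positivity)]
    have := mul_le_mul_of_nonneg_left (Nat.le_ceil (((N + 1 : ℕ) : ℝ) / T * t)) hT.le
    refine le_trans (le_of_eq ?_) this
    field_simp
  refine tendsto_nhdsWithin_iff.2 ⟨?_, Eventually.of_forall hle⟩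
  rw [tendsto_subtype_rng]
  refine tendsto_of_tendsto_of_tendsto_of_le_of_le (g := fun _ => (t : ℝ))
    (h := fun N : ℕ => (t : ℝ) + T / ((N + 1 : ℕ) : ℝ)) tendsto_const_nhds ?_ hle fun N => ?_
  · have := (tendsto_const_div_atTop_nhds_zero_nat T).comp (tendsto_add_atTop_nat 1)
    simpa using this.const_add (t : ℝ)
  · change (gridAbove hT N t : ℝ) ≤ _
    rw [hval, div_le_iff₀ (by positivity)]
    have h₀ : 0 ≤ ((N + 1 : ℕ) : ℝ) / T * t := mul_nonneg (by positivity) t.2.1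
    have := mul_le_mul_of_nonneg_left (Nat.ceil_lt_add_one h₀).le hT.le
    refine this.trans (le_of_eq ?_)
    field_simp

/-- A càdlàg function is strongly measurable. -/
lemma IsCadlag.stronglyMeasurable [PseudoMetricSpace S] (hT : 0 < T) {u : Icc (0 : ℝ) T → S}
    (hu : IsCadlag u) : StronglyMeasurable u := by
  refine stronglyMeasurable_of_tendsto atTop
    (f := fun (N : ℕ) (t : Icc (0 : ℝ) T) => u (gridAbove hT N t)) (fun N => ?_)
    (tendsto_pi_nhds.2 fun t => (hu t).1.tendsto.comp (tendsto_gridAbove hT t))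
  have hm : Measurable fun t : Icc (0 : ℝ) T => ⌈((N + 1 : ℕ) : ℝ) / T * t⌉₊ :=
    Nat.measurable_ceil.comp (measurable_subtype_coe.const_mul _)
  exact (StronglyMeasurable.of_discrete
    (f := fun i : ℕ => u (gridPoint hT (N + 1) i))).comp_measurable hm

/-- The supremum of a lower semicontinuous function along a right-continuous path is a countable
one. -/
lemma iSup_comp_eq_iSup_grid [TopologicalSpace S] (hT : 0 < T) {f : S → ℝ≥0∞}
    (hf : LowerSemicontinuous f) {u : Icc (0 : ℝ) T → S} (hu : IsCadlag u) :
    ⨆ t, f (u t) = ⨆ (N : ℕ) (i : ℕ), f (u (gridPoint hT N i)) := by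
  refine le_antisymm (iSup_le fun t => ?_) (iSup₂_le fun N i => le_iSup (fun t => f (u t)) _)
  have hclosed : IsClosed (f ⁻¹' Iic (⨆ (N : ℕ) (i : ℕ), f (u (gridPoint hT N i)))) :=
    hf.isClosed_preimage _
  exact hclosed.mem_of_tendsto ((hu t).1.tendsto.comp (tendsto_gridAbove hT t))
    (Eventually.of_forall fun N => le_iSup₂ (f := fun N i => f (u (gridPoint hT N i))) (N + 1) _)

end Grid

/-! ### Successive jumps of a discrete path -/

section Jumps

variable {E : Type*} [NormedAddCommGroup E]

open Classical in
/-- The first index `k ∈ (j, M]` with `‖v k - v j‖ ≥ a`, or `M + 1` if there is none. -/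
def nextJump (a : ℝ) (M : ℕ) (v : ℕ → E) (j : ℕ) : ℕ :=
  if h : ∃ k, j < k ∧ k ≤ M ∧ a ≤ ‖v k - v j‖ then Nat.find h else M + 1

/-- The successive indices at which `v` has moved by at least `a` since the previous one; from
the first failure on, the value is `M + 1`. -/
def jumpTime (a : ℝ) (M : ℕ) (v : ℕ → E) : ℕ → ℕ
  | 0 => 0
  | i + 1 => nextJump a M v (jumpTime a M v i)

variable {a : ℝ} {M : ℕ} {v : ℕ → E} {j k : ℕ}

lemma nextJump_eq_iff (hk : k ≤ M) :
    nextJump a M v j = k ↔ j < k ∧ (∀ l, j < l → l < k → ‖v l - v j‖ < a) ∧ a ≤ ‖v k - v j‖ := by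
  unfold nextJump
  split_ifs with h
  · rw [Nat.find_eq_iff]
    constructor
    · rintro ⟨⟨h₁, _, h₃⟩, h₄⟩
      refine ⟨h₁, fun l hl hlk => ?_, h₃⟩
      by_contra! hle
      exact h₄ l hlk ⟨hl, hlk.le.trans hk, hle⟩
    · rintro ⟨h₁, h₂, h₃⟩
      exact ⟨⟨h₁, hk, h₃⟩, fun l hl ⟨h₄, _, h₅⟩ => (h₂ l h₄ hl).not_ge h₅⟩
  · constructor
    · rintro rfl; omega
    · rintro ⟨h₁, _, h₃⟩
      exact absurd ⟨k, h₁, hk, h₃⟩ h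

lemma nextJump_le : nextJump a M v j ≤ M + 1 := by
  unfold nextJump
  split_ifs with h
  · exact (Nat.find_spec h).2.1.trans M.le_succ
  · exact le_rfl

lemma lt_nextJump (hj : j ≤ M) : j < nextJump a M v j := by
  rcases (nextJump_le (a := a) (M := M) (v := v) (j := j)).lt_or_eq with h | h
  · exact ((nextJump_eq_iff (Nat.lt_succ_iff.1 h)).1 rfl).1
  · omega

lemma le_norm_nextJump (h : nextJump a M v j ≤ M) : a ≤ ‖v (nextJump a M v j) - v j‖ :=
  ((nextJump_eq_iff h).1 rfl).2.2

lemma norm_lt_of_lt_nextJump (ha : 0 < a) (hjk : j ≤ k) (hk : k < nextJump a M v j)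
    (hkM : k ≤ M) : ‖v k - v j‖ < a := by
  rcases hjk.eq_or_lt with rfl | hjk
  · simpa using ha
  unfold nextJump at hk
  split_ifs at hk with h
  · by_contra! hle
    exact Nat.find_min h hk ⟨hjk, hkM, hle⟩
  · by_contra! hle
    exact h ⟨k, hjk, hkM, hle⟩

lemma jumpTime_le (i : ℕ) : jumpTime a M v i ≤ M + 1 := by
  cases i with
  | zero => exact Nat.zero_le _
  | succ i => exact nextJump_le

lemma jumpTime_mono : Monotone (jumpTime a M v) := by
  refine monotone_nat_of_le_succ fun i => ?_
  rcases (jumpTime_le (a := a) (M := M) (v := v) i).lt_or_eq with h | h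
  · exact (lt_nextJump (Nat.lt_succ_iff.1 h)).le
  · rw [h]
    change M + 1 ≤ nextJump a M v (jumpTime a M v i)
    rw [h]
    unfold nextJump
    split_ifs with h'
    · obtain ⟨h₁, h₂, _⟩ := Nat.find_spec h'
      omega
    · exact le_rfl

/-- If there are `q` jumps before `M`, at least half of them follow the previous one within
`e` steps, where `q e ≥ 2 M`. -/
lemma le_two_mul_card_short {q e : ℕ} (hqe : 2 * M ≤ q * e) (hq : jumpTime a M v q ≤ M) :
    q ≤ 2 * ((Finset.range q).filter fun i => jumpTime a M v (i + 1) ≤ M ∧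
      jumpTime a M v (i + 1) ≤ jumpTime a M v i + e).card := by
  set J := jumpTime a M v
  set B := (Finset.range q).filter fun i => J (i + 1) ≤ M ∧ J (i + 1) ≤ J i + e
  have hmono : Monotone J := jumpTime_mono
  have key : ∀ n ≤ q, (n - (B.filter (· < n)).card) * (e + 1) ≤ J n := by
    intro n hn
    induction n with
    | zero => simp
    | succ n ih =>
      have ih := ih (Nat.le_of_succ_le hn)
      have hstep := hmono n.le_succ
      by_cases hB : n ∈ B
      · have : (B.filter (· < n + 1)).card = (B.filter (· < n)).card + 1 := by
          have : B.filter (· < n + 1) = insert n (B.filter (· < n)) := by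
            ext x
            simp only [Finset.mem_filter, Finset.mem_insert]
            constructor
            · rintro ⟨h₁, h₂⟩
              rcases Nat.lt_succ_iff_lt_or_eq.1 h₂ with h | h
              · exact Or.inr ⟨h₁, h⟩
              · exact Or.inl h
            · rintro (rfl | ⟨h₁, h₂⟩)
              · exact ⟨hB, Nat.lt_succ_self _⟩
              · exact ⟨h₁, h₂.trans (Nat.lt_succ_self _)⟩
          rw [this, Finset.card_insert_of_notMem (by simp)]
        rw [this, Nat.add_sub_add_right]
        exact ih.trans hstep
      · have hsub : (B.filter (· < n)).card ≤ (B.filter (· < n + 1)).card :=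
          Finset.card_le_card fun x hx => by
            simp only [Finset.mem_filter] at hx ⊢
            exact ⟨hx.1, hx.2.trans (Nat.lt_succ_self _)⟩
        have hJ : J n + e < J (n + 1) := by
          by_contra! hle
          exact hB (Finset.mem_filter.2 ⟨Finset.mem_range.2 hn, (hmono hn).trans hq, hle⟩)
        calc (n + 1 - (B.filter (· < n + 1)).card) * (e + 1)
            ≤ (n - (B.filter (· < n)).card + 1) * (e + 1) :=
              Nat.mul_le_mul_right _ (by omega)
          _ ≤ J (n + 1) := by rw [Nat.add_mul]; omega
  have hB : B.filter (· < q) = B := Finset.filter_true_of_mem fun x hx =>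
    Finset.mem_range.1 (Finset.mem_filter.1 hx).1
  have h := (key q le_rfl).trans hq
  rw [hB] at h
  by_contra! hlt
  have h₁ : q + 1 ≤ 2 * (q - B.card) := by omega
  have h₂ := Nat.mul_le_mul_right (e + 1) h₁
  nlinarith

variable {T : ℝ}

/-- If a discrete path has less than `q` jumps of size `a`, more than `e` steps apart, and moves
by less than `a` during the last `e` steps, then the corresponding step function has a partition
with mesh `e T / M`. The jumps among the last `e` steps are not points of the partition, which
costs an additional `2 a` in the oscillation. -/
lemma hasOscPartition_of_jumps (hT : 0 < T) (ha : 0 < a) (hM : 0 < M)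
    {X : Icc (0 : ℝ) T → E} (hv : ∀ j, v j = X (gridPoint hT M j)) {q e : ℕ} (heM : e ≤ M)
    (hq : M < jumpTime a M v q)
    (hgap : ∀ i < q, jumpTime a M v (i + 1) ≤ M → jumpTime a M v i + e < jumpTime a M v (i + 1))
    (hend : M < nextJump a M v (M - e)) :
    HasOscPartition (discretize hT M X).toFun (T * e / M) (4 * a) := by
  set J := jumpTime a M v with hJ
  have hmono : Monotone J := jumpTime_mono
  let D : Set ℕ := {j | j = M ∨ (∃ i, J i = j) ∧ j ≤ M - e}
  have hDM : ∀ j ∈ D, j ≤ M := by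
    rintro j (rfl | ⟨_, h⟩) <;> omega
  have hDgap : ∀ j ∈ D, ∀ k ∈ D, j < k → j + e ≤ k := by
    rintro j (rfl | ⟨⟨i, rfl⟩, hi⟩) k hk hjk
    · exact absurd (hDM k hk) (by omega)
    rcases hk with rfl | ⟨⟨i', rfl⟩, hi'⟩
    · omega
    have hii : i < i' := hmono.reflect_lt hjk
    have hi'q : i' < q := by
      by_contra! h
      have := hmono h
      omega
    have h₁ : J (i + 1) ≤ J i' := hmono (Nat.succ_le_of_lt hii)
    have h₂ := hgap i (hii.trans hi'q) (by omega)
    omega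
  have hM' : (0 : ℝ) < M := Nat.cast_pos.2 hM
  refine ⟨gridPoint hT M '' D, ?_, ?_, ?_⟩
  · rintro t (ht | ht)
    · refine ⟨0, Or.inr ⟨⟨0, rfl⟩, Nat.zero_le _⟩, Subtype.ext ?_⟩
      rw [coe_gridPoint hT (Nat.zero_le _), ht]
      simp
    · refine ⟨M, Or.inl rfl, Subtype.ext ?_⟩
      rw [coe_gridPoint hT le_rfl, ht]
      field_simp
  · have key : ∀ j ∈ D, ∀ k ∈ D, j < k →
        T * e / M ≤ |(gridPoint hT M j : ℝ) - gridPoint hT M k| := by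
      intro j hj k hk hjk
      rw [coe_gridPoint hT (hDM j hj), coe_gridPoint hT (hDM k hk), abs_sub_comm, ← sub_div,
        ← mul_sub]
      refine le_trans ?_ (le_abs_self _)
      have : (j : ℝ) + e ≤ k := by exact_mod_cast hDgap j hj k hk hjk
      gcongr
      linarith
    rintro _ ⟨j, hj, rfl⟩ _ ⟨k, hk, rfl⟩ hne
    rcases lt_trichotomy j k with h | rfl | h
    · exact key j hj k hk h
    · exact absurd rfl hne
    · rw [abs_sub_comm]; exact key k hk j hj h
  · intro s t hst
    have hst' : ∀ d ∈ D, d ≤ gridIndex M s ↔ d ≤ gridIndex M t := by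
      intro d hd
      have := hst _ ⟨d, hd, rfl⟩
      rwa [← Subtype.coe_le_coe, ← Subtype.coe_le_coe, coe_gridPoint hT (hDM d hd),
        ← le_gridIndex_iff hT hM, ← le_gridIndex_iff hT hM] at this
    rw [discretize_apply, discretize_apply, ← hv, ← hv]
    have hs := Nat.lt_succ_iff.1 (gridIndex_lt M s)
    have ht := Nat.lt_succ_iff.1 (gridIndex_lt M t)
    generalize gridIndex M s = j at *
    generalize gridIndex M t = k at *
    rcases hs.eq_or_lt with rfl | hj
    · have : k = j := le_antisymm ht ((hst' j (Or.inl rfl)).1 le_rfl)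
      rw [this, dist_self]
      positivity
    have hk : k < M := by
      refine ht.lt_of_ne ?_
      rintro rfl
      exact absurd ((hst' k (Or.inl rfl)).2 le_rfl) (by omega)
    -- `J i` is the last point of the partition before `j` and `k`
    obtain ⟨i, hi₁, hi₂⟩ : ∃ i, J i ≤ min j (M - e) ∧ min j (M - e) < J (i + 1) := by
      have hex : ∃ n, min j (M - e) < J n := ⟨q, by omega⟩
      classical
      have hpos : Nat.find hex ≠ 0 := by
        intro h
        have := Nat.find_spec hex
        rw [h] at this
        exact absurd this (Nat.not_lt_zero _)
      obtain ⟨i, hi⟩ := Nat.exists_eq_succ_of_ne_zero hpos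
      refine ⟨i, ?_, ?_⟩
      · have := Nat.find_min hex (m := i) (by omega)
        omega
      · have := Nat.find_spec hex
        rwa [hi] at this
    have hclose : ∀ l, l < M → J i ≤ l → (l < J (i + 1) ∨ M - e < J (i + 1)) →
        ‖v l - v (J i)‖ < 2 * a := by
      intro l hl hil hor
      by_cases hlt : l < J (i + 1)
      · have := norm_lt_of_lt_nextJump ha hil hlt hl.le
        linarith
      · have h₁ : M - e < J (i + 1) := hor.resolve_left hlt
        have h₂ : ‖v (M - e) - v (J i)‖ < a :=
          norm_lt_of_lt_nextJump ha (hi₁.trans (min_le_right _ _)) h₁ (Nat.sub_le _ _)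
        have h₃ : ‖v l - v (M - e)‖ < a :=
          norm_lt_of_lt_nextJump ha (by omega) (by omega) hl.le
        have := norm_sub_le_norm_sub_add_norm_sub (v l) (v (M - e)) (v (J i))
        linarith
    have hJi : J i ∈ D := Or.inr ⟨⟨i, rfl⟩, hi₁.trans (min_le_right _ _)⟩
    have h₁ := hclose j hj (hi₁.trans (min_le_left _ _)) (by omega)
    have h₂ := hclose k hk ((hst' _ hJi).1 (hi₁.trans (min_le_left _ _))) (by
      by_contra! hcon
      have hD : J (i + 1) ∈ D := Or.inr ⟨⟨i + 1, rfl⟩, hcon.2⟩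
      have := (hst' _ hD).2 hcon.1
      omega)
    rw [dist_eq_norm]
    have := norm_sub_le_norm_sub_add_norm_sub (v j) (v (J i)) (v k)
    rw [norm_sub_rev (v (J i))] at this
    linarith

end Jumps

/-! ### The Aldous condition along grids -/

section Aldous

variable {Ω : Type*} {mΩ : MeasurableSpace Ω} {P : Measure Ω}

/-- Markov's inequality for the number of events that occur. -/
lemma mul_measure_le_card_le {ι : Type*} (s : Finset ι) (B : ι → Set Ω)
    [∀ ω i, Decidable (ω ∈ B i)] (e m : ℕ) :
    (e : ℝ≥0∞) * P {ω | e ≤ m * (s.filter fun i => ω ∈ B i).card} ≤ m * ∑ i ∈ s, P (B i) := by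
  let f : Ω → ℝ≥0∞ := fun ω => m * ∑ i ∈ s, (toMeasurable P (B i)).indicator 1 ω
  have hm : ∀ i ∈ s, Measurable ((toMeasurable P (B i)).indicator (1 : Ω → ℝ≥0∞)) := fun i _ =>
    measurable_one.indicator (measurableSet_toMeasurable P (B i))
  have hf : Measurable f := (Finset.measurable_fun_sum s hm).const_mul _
  have hint : ∫⁻ ω, f ω ∂P = m * ∑ i ∈ s, P (B i) := by
    rw [lintegral_const_mul _ (Finset.measurable_fun_sum s hm), lintegral_finsetSum _ hm]
    congr 1
    refine Finset.sum_congr rfl fun i _ => ?_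
    rw [lintegral_indicator_one (measurableSet_toMeasurable P (B i)), measure_toMeasurable]
  rw [← hint]
  refine (mul_le_mul' le_rfl (measure_mono fun ω hω => ?_)).trans (mul_meas_ge_le_lintegral hf e)
  change (e : ℝ≥0∞) ≤ f ω
  replace hω : e ≤ m * (s.filter fun i => ω ∈ B i).card := hω
  have h₁ : ((s.filter fun i => ω ∈ B i).card : ℝ≥0∞)
      ≤ ∑ i ∈ s, (toMeasurable P (B i)).indicator 1 ω := by
    rw [Finset.card_filter, Nat.cast_sum]
    refine Finset.sum_le_sum fun i _ => ?_
    split_ifs with h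
    · rw [indicator_of_mem (subset_toMeasurable P (B i) h)]; simp
    · simp
  calc (e : ℝ≥0∞) ≤ m * ((s.filter fun i => ω ∈ B i).card : ℝ≥0∞) := by exact_mod_cast hω
    _ ≤ f ω := mul_le_mul' le_rfl h₁

variable {E : Type*} [NormedAddCommGroup E]

/-- If the increments of `ξ` over `k ≤ 2 e` steps after `τ₁` and after `τ₂` are rarely large, then
so is the increment from `τ₁` to `τ₂` when `τ₁ ≤ τ₂ ≤ τ₁ + e`: outside of a small event, some
`k ≤ e` makes both `ξ (τ₂ + k) - ξ τ₂` and `ξ (τ₂ + k) - ξ τ₁` small. -/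
lemma measure_increment_le {ξ : ℕ → Ω → E} {τ₁ τ₂ : Ω → ℕ} {e : ℕ} (he : 0 < e) {η : ℝ} {p : ℝ≥0∞}
    (h₁ : ∀ k, 1 ≤ k → k ≤ 2 * e → P {ω | η ≤ ‖ξ (τ₁ ω + k) ω - ξ (τ₁ ω) ω‖} ≤ p)
    (h₂ : ∀ k, 1 ≤ k → k ≤ 2 * e → P {ω | η ≤ ‖ξ (τ₂ ω + k) ω - ξ (τ₂ ω) ω‖} ≤ p) :
    P {ω | τ₁ ω ≤ τ₂ ω ∧ τ₂ ω ≤ τ₁ ω + e ∧ 2 * η ≤ ‖ξ (τ₂ ω) ω - ξ (τ₁ ω) ω‖} ≤ 8 * p := by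
  classical
  let B : (Ω → ℕ) → ℕ → Set Ω := fun τ k => {ω | η ≤ ‖ξ (τ ω + k) ω - ξ (τ ω) ω‖}
  let G : (Ω → ℕ) → Set Ω := fun τ =>
    {ω | e ≤ 2 * ((Finset.Icc 1 (2 * e)).filter fun k => ω ∈ B τ k).card}
  have hG : ∀ τ : Ω → ℕ, (∀ k, 1 ≤ k → k ≤ 2 * e → P (B τ k) ≤ p) → P (G τ) ≤ 4 * p := by
    intro τ hτ
    have he' : (e : ℝ≥0∞) ≠ 0 := Nat.cast_ne_zero.2 he.ne'
    have h := mul_measure_le_card_le (P := P) (Finset.Icc 1 (2 * e)) (B τ) e 2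
    have hs : ∑ k ∈ Finset.Icc 1 (2 * e), P (B τ k) ≤ 2 * e * p := by
      refine (Finset.sum_le_card_nsmul _ _ p fun k hk => ?_).trans (le_of_eq ?_)
      · exact hτ k (Finset.mem_Icc.1 hk).1 (Finset.mem_Icc.1 hk).2
      · simp
    have h' : (e : ℝ≥0∞) * P (G τ) ≤ e * (4 * p) := by
      refine h.trans ?_
      calc ((2 : ℕ) : ℝ≥0∞) * ∑ k ∈ Finset.Icc 1 (2 * e), P (B τ k)
          ≤ ((2 : ℕ) : ℝ≥0∞) * (2 * e * p) := by gcongr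
        _ = e * (4 * p) := by push_cast; ring
    exact (ENNReal.mul_le_mul_iff_right he' (ENNReal.natCast_ne_top e)).1 h'
  have hsub : {ω | τ₁ ω ≤ τ₂ ω ∧ τ₂ ω ≤ τ₁ ω + e ∧ 2 * η ≤ ‖ξ (τ₂ ω) ω - ξ (τ₁ ω) ω‖}
      ⊆ G τ₁ ∪ G τ₂ := by
    rintro ω ⟨hle, hlee, hω⟩
    by_contra hcon
    rw [mem_union, not_or] at hcon
    obtain ⟨hc₁, hc₂⟩ := hcon
    simp only [G, mem_ofPred_eq, not_le] at hc₁ hc₂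
    obtain ⟨r, hr⟩ := Nat.exists_eq_add_of_le hle
    set A₁ := (Finset.Icc 1 (2 * e)).filter fun k => ω ∈ B τ₁ k
    set A₂ := (Finset.Icc 1 (2 * e)).filter fun k => ω ∈ B τ₂ k
    obtain ⟨k, hk, hkn⟩ : ∃ k ∈ Finset.Icc 1 e,
        k ∉ A₂ ∪ (Finset.Icc 1 e).filter fun k => r + k ∈ A₁ := by
      refine Finset.exists_mem_notMem_of_card_lt_card ?_
      have h₃ : ((Finset.Icc 1 e).filter fun k => r + k ∈ A₁).card ≤ A₁.card :=
        Finset.card_le_card_of_injOn (fun k => r + k)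
          (fun k hk => (Finset.mem_filter.1 hk).2) (fun a _ b _ h => Nat.add_left_cancel h)
      have h₄ := Finset.card_union_le A₂ ((Finset.Icc 1 e).filter fun k => r + k ∈ A₁)
      rw [Nat.card_Icc]
      omega
    rw [Finset.mem_Icc] at hk
    rw [Finset.mem_union, not_or] at hkn
    have n₂ : ‖ξ (τ₂ ω + k) ω - ξ (τ₂ ω) ω‖ < η := by
      by_contra! h
      exact hkn.1 (Finset.mem_filter.2 ⟨Finset.mem_Icc.2 ⟨hk.1, by omega⟩, h⟩)
    have n₁ : ‖ξ (τ₂ ω + k) ω - ξ (τ₁ ω) ω‖ < η := by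
      by_contra! h
      refine hkn.2 (Finset.mem_filter.2 ⟨Finset.mem_Icc.2 hk,
        Finset.mem_filter.2 ⟨Finset.mem_Icc.2 ⟨by omega, by omega⟩, ?_⟩⟩)
      rw [hr, add_assoc] at h
      exact h
    have := norm_sub_le_norm_sub_add_norm_sub (ξ (τ₂ ω) ω) (ξ (τ₂ ω + k) ω) (ξ (τ₁ ω) ω)
    rw [norm_sub_rev (ξ (τ₂ ω) ω) (ξ (τ₂ ω + k) ω)] at this
    linarith
  calc _ ≤ P (G τ₁ ∪ G τ₂) := measure_mono hsub
    _ ≤ P (G τ₁) + P (G τ₂) := measure_union_le _ _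
    _ ≤ 4 * p + 4 * p := add_le_add (hG τ₁ h₁) (hG τ₂ h₂)
    _ = 8 * p := by ring

variable {T : ℝ} (𝓕 : Filtration (Icc (0 : ℝ) T) mΩ)

/-- A stopping time with values in the indices of the grid `{i T / M}`. -/
structure IsGridStoppingTime (hT : 0 < T) (M : ℕ) (τ : Ω → ℕ) : Prop where
  le : ∀ ω, τ ω ≤ M
  measurableSet_le : ∀ k, k < M → MeasurableSet[𝓕 (gridPoint hT M k)] {ω | τ ω ≤ k}

variable {𝓕}

lemma gridPoint_mono (hT : 0 < T) (M : ℕ) : Monotone (gridPoint hT M) := fun i j hij =>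
  monotone_projIcc hT.le (by gcongr)

lemma IsGridStoppingTime.isStoppingTime {hT : 0 < T} {M : ℕ} (hM : 0 < M) {τ : Ω → ℕ}
    (hτ : IsGridStoppingTime 𝓕 hT M τ) :
    IsStoppingTime 𝓕 fun ω => (gridPoint hT M (τ ω) : WithTop (Icc (0 : ℝ) T)) := by
  intro t
  have h : {ω | (gridPoint hT M (τ ω) : WithTop (Icc (0 : ℝ) T)) ≤ t}
      = {ω | τ ω ≤ gridIndex M t} := by
    ext ω
    rw [mem_ofPred_eq, WithTop.coe_le_coe, ← Subtype.coe_le_coe, coe_gridPoint hT (hτ.le ω),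
      mem_ofPred_eq, le_gridIndex_iff hT hM]
  rw [h]
  have hle := Nat.lt_succ_iff.1 (gridIndex_lt M t)
  rcases hle.eq_or_lt with heq | hlt
  · rw [heq, show {ω | τ ω ≤ M} = univ from eq_univ_of_forall hτ.le]
    exact MeasurableSet.univ
  · refine 𝓕.mono ?_ _ (hτ.measurableSet_le _ hlt)
    rw [← Subtype.coe_le_coe, coe_gridPoint hT hle]
    exact (le_gridIndex_iff hT hM t _).1 le_rfl

/-- The Aldous condition, for one process and one choice of the constants. -/
def AldousBound (hT : 0 < T) (P : Measure Ω) (𝓕 : Filtration (Icc (0 : ℝ) T) mΩ)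
    (X : Icc (0 : ℝ) T → Ω → E) (p : ℝ≥0∞) (η δ : ℝ) : Prop :=
  ∀ τ : Ω → Icc (0 : ℝ) T, IsStoppingTime 𝓕 (fun ω => (τ ω : WithTop (Icc (0 : ℝ) T))) →
    ∀ θ : ℝ, 0 < θ → θ ≤ δ →
      P {ω | η ≤ ‖X (projIcc 0 T hT.le ((τ ω : ℝ) + θ)) ω - X (τ ω) ω‖} ≤ p

lemma AldousBound.grid {hT : 0 < T} {X : Icc (0 : ℝ) T → Ω → E} {p : ℝ≥0∞} {η δ : ℝ}
    (hX : AldousBound hT P 𝓕 X p η δ) {M : ℕ} (hM : 0 < M) {τ : Ω → ℕ}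
    (hτ : IsGridStoppingTime 𝓕 hT M τ) {k : ℕ} (hk : 1 ≤ k) (hkδ : T * k / M ≤ δ) :
    P {ω | η ≤ ‖X (gridPoint hT M (τ ω + k)) ω - X (gridPoint hT M (τ ω)) ω‖} ≤ p := by
  have hk' : (0 : ℝ) < k := Nat.cast_pos.2 hk
  have hM' : (0 : ℝ) < M := Nat.cast_pos.2 hM
  have h := hX _ (hτ.isStoppingTime hM) (T * k / M) (by positivity) hkδ
  have e : ∀ ω, projIcc 0 T hT.le ((gridPoint hT M (τ ω) : ℝ) + T * k / M)
      = gridPoint hT M (τ ω + k) := fun ω => by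
    rw [coe_gridPoint hT (hτ.le ω), ← add_div, ← mul_add, gridPoint, Nat.cast_add]
  simpa only [e] using h

lemma measurableSet_nextJump_eq {hT : 0 < T} {X : Icc (0 : ℝ) T → Ω → E}
    (hX : StronglyAdapted 𝓕 X) {M k : ℕ} (a : ℝ) (j : ℕ) (hk : k ≤ M) :
    MeasurableSet[𝓕 (gridPoint hT M k)]
      {ω | nextJump a M (fun i => X (gridPoint hT M i) ω) j = k} := by
  simp only [nextJump_eq_iff hk]
  rcases lt_or_ge j k with hjk | hjk
  swap
  · simp [hjk.not_gt]
  have hm : ∀ i ≤ k, StronglyMeasurable[𝓕 (gridPoint hT M k)] (X (gridPoint hT M i)) :=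
    fun i hi => (hX _).mono (𝓕.mono (gridPoint_mono hT M hi))
  have hn : ∀ i ≤ k, Measurable[𝓕 (gridPoint hT M k)]
      fun ω => ‖X (gridPoint hT M i) ω - X (gridPoint hT M j) ω‖ := fun i hi =>
    ((hm i hi).sub (hm j hjk.le)).norm.measurable
  have hset : {ω | j < k ∧ (∀ l, j < l → l < k →
      ‖X (gridPoint hT M l) ω - X (gridPoint hT M j) ω‖ < a) ∧
      a ≤ ‖X (gridPoint hT M k) ω - X (gridPoint hT M j) ω‖}
      = (⋂ l, ⋂ (_ : j < l), ⋂ (_ : l < k),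
        {ω | ‖X (gridPoint hT M l) ω - X (gridPoint hT M j) ω‖ < a}) ∩
        {ω | a ≤ ‖X (gridPoint hT M k) ω - X (gridPoint hT M j) ω‖} := by
    ext ω
    simp [hjk]
  rw [hset]
  refine MeasurableSet.inter (MeasurableSet.iInter fun l => MeasurableSet.iInter fun _ =>
    MeasurableSet.iInter fun hl => ?_) ?_
  · exact (hn l hl.le) measurableSet_Iio
  · exact (hn k le_rfl) measurableSet_Ici

lemma measurableSet_jumpTime_eq {hT : 0 < T} {X : Icc (0 : ℝ) T → Ω → E}
    (hX : StronglyAdapted 𝓕 X) {M : ℕ} (a : ℝ) (i : ℕ) {k : ℕ} (hk : k ≤ M) :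
    MeasurableSet[𝓕 (gridPoint hT M k)]
      {ω | jumpTime a M (fun j => X (gridPoint hT M j) ω) i = k} := by
  induction i generalizing k with
  | zero => simp [jumpTime]
  | succ i ih =>
    have hset : {ω | jumpTime a M (fun j => X (gridPoint hT M j) ω) (i + 1) = k}
        = ⋃ j, ⋃ (_ : j < k), {ω | jumpTime a M (fun j => X (gridPoint hT M j) ω) i = j} ∩
          {ω | nextJump a M (fun j => X (gridPoint hT M j) ω) j = k} := by
      ext ω
      simp only [mem_ofPred_eq, mem_iUnion, mem_inter_iff, exists_prop]
      constructor
      · intro h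
        exact ⟨_, ((nextJump_eq_iff hk).1 h).1, rfl, h⟩
      · rintro ⟨j, _, rfl, h⟩
        exact h
    rw [hset]
    refine MeasurableSet.iUnion fun j => MeasurableSet.iUnion fun hj => MeasurableSet.inter ?_ ?_
    · exact 𝓕.mono (gridPoint_mono hT M hj.le) _ (ih (hj.le.trans hk))
    · exact measurableSet_nextJump_eq hX a j hk

lemma isGridStoppingTime_min {hT : 0 < T} {M : ℕ} {τ : Ω → ℕ}
    (h : ∀ k, k ≤ M → MeasurableSet[𝓕 (gridPoint hT M k)] {ω | τ ω = k}) :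
    IsGridStoppingTime 𝓕 hT M fun ω => min (τ ω) M := by
  refine ⟨fun ω => min_le_right _ _, fun k hk => ?_⟩
  have hset : {ω | min (τ ω) M ≤ k} = ⋃ j, ⋃ (_ : j ≤ k), {ω | τ ω = j} := by
    ext ω
    simp [hk.not_ge]
  rw [hset]
  exact MeasurableSet.iUnion fun j => MeasurableSet.iUnion fun hj =>
    𝓕.mono (gridPoint_mono hT M hj) _ (h j (hj.trans hk.le))

lemma isGridStoppingTime_const {hT : 0 < T} {M j : ℕ} (hj : j ≤ M) :
    IsGridStoppingTime 𝓕 hT M fun _ : Ω => j :=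
  ⟨fun _ => hj, fun _ _ => MeasurableSet.const _⟩

/-- Under the Aldous condition a discretized process has a partition with small oscillation, up to
an event of small probability. The first bound controls the number of jumps of size `2 η`, and
the second one, at a smaller level, their distances. -/
lemma measure_not_hasOscPartition_le {hT : 0 < T} {X : Icc (0 : ℝ) T → Ω → E}
    (hX : StronglyAdapted 𝓕 X) {η δ₁ δ₂ : ℝ} (hη : 0 < η) {p₁ p₂ : ℝ≥0∞}
    (h₁ : AldousBound hT P 𝓕 X p₁ η δ₁) (h₂ : AldousBound hT P 𝓕 X p₂ η δ₂)
    {M q e₁ e₂ : ℕ} (hM : 0 < M) (he₁ : 0 < e₁) (he₂ : 0 < e₂) (heM : e₂ ≤ M)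
    (hq : 2 * M ≤ q * e₁) (hδ₁ : T * (2 * e₁) / M ≤ δ₁) (hδ₂ : T * (2 * e₂) / M ≤ δ₂) :
    P {ω | ¬ HasOscPartition (discretize hT M fun t => X t ω).toFun (T * e₂ / M) (8 * η)}
      ≤ 16 * p₁ + (q + 1) * (8 * p₂) := by
  classical
  have hM' : (0 : ℝ) < M := Nat.cast_pos.2 hM
  let ξ : ℕ → Ω → E := fun j ω => X (gridPoint hT M j) ω
  let J : ℕ → Ω → ℕ := fun i ω => jumpTime (2 * η) M (fun j => ξ j ω) i
  let ν : Ω → ℕ := fun ω => nextJump (2 * η) M (fun j => ξ j ω) (M - e₂)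
  have hJ : ∀ i, IsGridStoppingTime 𝓕 hT M fun ω => min (J i ω) M := fun i =>
    isGridStoppingTime_min fun k hk => measurableSet_jumpTime_eq hX _ i hk
  have hν : IsGridStoppingTime 𝓕 hT M fun ω => min (ν ω) M :=
    isGridStoppingTime_min fun k hk => measurableSet_nextJump_eq hX _ _ hk
  have hinc : ∀ {δ : ℝ} {p : ℝ≥0∞} {e : ℕ}, AldousBound hT P 𝓕 X p η δ → 0 < e →
      T * (2 * e) / M ≤ δ → ∀ τ₁ τ₂ : Ω → ℕ, IsGridStoppingTime 𝓕 hT M τ₁ →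
      IsGridStoppingTime 𝓕 hT M τ₂ →
      P {ω | τ₁ ω ≤ τ₂ ω ∧ τ₂ ω ≤ τ₁ ω + e ∧ 2 * η ≤ ‖ξ (τ₂ ω) ω - ξ (τ₁ ω) ω‖} ≤ 8 * p := by
    intro δ p e hA he hδ τ₁ τ₂ hτ₁ hτ₂
    have hk : ∀ k : ℕ, k ≤ 2 * e → T * k / M ≤ δ := fun k hk => by
      refine le_trans ?_ hδ
      have : (k : ℝ) ≤ 2 * e := by exact_mod_cast hk
      gcongr
    exact measure_increment_le he (fun k hk₁ hk₂ => hA.grid hM hτ₁ hk₁ (hk k hk₂))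
      fun k hk₁ hk₂ => hA.grid hM hτ₂ hk₁ (hk k hk₂)
  let B : ℕ → ℕ → Set Ω := fun e i => {ω | J (i + 1) ω ≤ M ∧ J (i + 1) ω ≤ J i ω + e}
  have hB : ∀ {δ : ℝ} {p : ℝ≥0∞} {e : ℕ}, AldousBound hT P 𝓕 X p η δ → 0 < e →
      T * (2 * e) / M ≤ δ → ∀ i, P (B e i) ≤ 8 * p := by
    intro δ p e hA he hδ i
    refine (measure_mono ?_).trans (hinc hA he hδ _ _ (hJ i) (hJ (i + 1)))
    rintro ω ⟨hω₁, hω₂⟩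
    have hle : J i ω ≤ J (i + 1) ω := jumpTime_mono i.le_succ
    have hjump : 2 * η ≤ ‖ξ (J (i + 1) ω) ω - ξ (J i ω) ω‖ := le_norm_nextJump hω₁
    simp only [mem_ofPred_eq, min_eq_left hω₁, min_eq_left (hle.trans hω₁)]
    exact ⟨hle, hω₂, hjump⟩
  have hevent₁ : P {ω | J q ω ≤ M} ≤ 16 * p₁ := by
    have hq0 : 0 < q := Nat.pos_of_ne_zero fun h => by subst h; omega
    have hsub : {ω | J q ω ≤ M}
        ⊆ {ω | q ≤ 2 * ((Finset.range q).filter fun i => ω ∈ B e₁ i).card} := fun ω hω =>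
      le_two_mul_card_short hq hω
    have hmarkov := mul_measure_le_card_le (P := P) (Finset.range q) (B e₁) q 2
    have hsum : ∑ i ∈ Finset.range q, P (B e₁ i) ≤ q * (8 * p₁) := by
      refine (Finset.sum_le_card_nsmul _ _ _ fun i _ => hB h₁ he₁ hδ₁ i).trans (le_of_eq ?_)
      simp
    have : (q : ℝ≥0∞) * P {ω | J q ω ≤ M} ≤ q * (16 * p₁) := by
      calc (q : ℝ≥0∞) * P {ω | J q ω ≤ M}
          ≤ q * P {ω | q ≤ 2 * ((Finset.range q).filter fun i => ω ∈ B e₁ i).card} := by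
            gcongr
        _ ≤ (2 : ℕ) * ∑ i ∈ Finset.range q, P (B e₁ i) := hmarkov
        _ ≤ (2 : ℕ) * (q * (8 * p₁)) := by gcongr
        _ = q * (16 * p₁) := by push_cast; ring
    exact (ENNReal.mul_le_mul_iff_right (Nat.cast_ne_zero.2 hq0.ne')
      (ENNReal.natCast_ne_top q)).1 this
  have hevent₂ : P (⋃ i ∈ Finset.range q, B e₂ i) ≤ q * (8 * p₂) := by
    refine (measure_biUnion_finset_le _ _).trans ?_
    refine (Finset.sum_le_card_nsmul _ _ _ fun i _ => hB h₂ he₂ hδ₂ i).trans (le_of_eq ?_)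
    simp
  have hevent₃ : P {ω | ν ω ≤ M} ≤ 8 * p₂ := by
    refine (measure_mono ?_).trans (hinc h₂ he₂ hδ₂ _ _
      (isGridStoppingTime_const (Nat.sub_le M e₂)) hν)
    intro ω hω
    have hω' : ν ω ≤ M := hω
    have hlt : M - e₂ < ν ω := lt_nextJump (Nat.sub_le _ _)
    have hjump : 2 * η ≤ ‖ξ (ν ω) ω - ξ (M - e₂) ω‖ := le_norm_nextJump hω'
    simp only [mem_ofPred_eq, min_eq_left hω']
    exact ⟨hlt.le, by omega, hjump⟩
  have hsub : {ω | ¬ HasOscPartition (discretize hT M fun t => X t ω).toFun (T * e₂ / M) (8 * η)}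
      ⊆ {ω | J q ω ≤ M} ∪ ((⋃ i ∈ Finset.range q, B e₂ i) ∪ {ω | ν ω ≤ M}) := by
    intro ω hω
    by_contra hcon
    simp only [mem_union, not_or, mem_ofPred_eq, not_le, mem_iUnion, not_exists] at hcon
    obtain ⟨hc₁, hc₂, hc₃⟩ := hcon
    refine hω ?_
    rw [show 8 * η = 4 * (2 * η) by ring]
    refine hasOscPartition_of_jumps hT (by positivity) hM (v := fun j => ξ j ω) (fun j => rfl) heM
      hc₁ (fun i hi hiM => ?_) hc₃
    by_contra! hle
    exact hc₂ i (Finset.mem_range.2 hi) ⟨hiM, hle⟩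
  calc _ ≤ P ({ω | J q ω ≤ M} ∪ ((⋃ i ∈ Finset.range q, B e₂ i) ∪ {ω | ν ω ≤ M})) :=
        measure_mono hsub
    _ ≤ P {ω | J q ω ≤ M} + (P (⋃ i ∈ Finset.range q, B e₂ i) + P {ω | ν ω ≤ M}) :=
        (measure_union_le _ _).trans (by gcongr; exact measure_union_le _ _)
    _ ≤ 16 * p₁ + (q * (8 * p₂) + 8 * p₂) := by gcongr
    _ = _ := by ring

end Aldous

/-! ### Uniform approximation by discretized paths -/

section AldousUniform

variable {Ω : Type*} {mΩ : MeasurableSpace Ω} {P : Measure Ω} {E : Type*} [NormedAddCommGroup E]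
  {T : ℝ} {𝓕 : Filtration (Icc (0 : ℝ) T) mΩ}

lemma HasOscPartition.mono {S : Type*} [PseudoMetricSpace S] {u : Icc (0 : ℝ) T → S}
    {δ δ' ε : ℝ} (hu : HasOscPartition u δ ε) (h : δ' ≤ δ) : HasOscPartition u δ' ε := by
  obtain ⟨D, h₁, h₂, h₃⟩ := hu
  exact ⟨D, h₁, fun a ha b hb hab => h.trans (h₂ a ha b hb hab), h₃⟩

/-- The càdlàg moduli of the discretized processes are small in probability, uniformly over the
processes and over all fine grids. -/
lemma exists_measure_not_hasOscPartition_le {ι : Type*} (hT : 0 < T) {X : ι → Icc (0 : ℝ) T → Ω → E}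
    (hX : ∀ n, StronglyAdapted 𝓕 (X n))
    (hA : ∀ ε : ℝ, 0 < ε → ∀ η : ℝ, 0 < η → ∃ δ : ℝ, 0 < δ ∧
      ∀ n, AldousBound hT P 𝓕 (X n) (ENNReal.ofReal ε) η δ)
    {ε η : ℝ} (hε : 0 < ε) (hη : 0 < η) :
    ∃ δ : ℝ, 0 < δ ∧ ∃ M₀ : ℕ, ∀ n, ∀ M, M₀ ≤ M →
      P {ω | ¬ HasOscPartition (discretize hT M fun t => X n t ω).toFun δ (8 * η)}
        ≤ ENNReal.ofReal ε := by
  obtain ⟨δ₁, hδ₁, h₁⟩ := hA (ε / 32) (by positivity) η hη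
  obtain ⟨q, hq⟩ := exists_nat_ge (8 * T / δ₁)
  obtain ⟨δ₂', hδ₂', h₂'⟩ := hA (ε / (16 * (q + 1))) (by positivity) η hη
  set δ₂ := min δ₂' T
  have hδ₂ : 0 < δ₂ := lt_min hδ₂' hT
  have h₂ : ∀ n, AldousBound hT P 𝓕 (X n) (ENNReal.ofReal (ε / (16 * (q + 1)))) η δ₂ :=
    fun n τ hτ θ hθ hθδ => h₂' n τ hτ θ hθ (hθδ.trans (min_le_left _ _))
  obtain ⟨M₁, hM₁⟩ := exists_nat_ge (2 * T / δ₁)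
  obtain ⟨M₂, hM₂⟩ := exists_nat_ge (2 * T / δ₂)
  refine ⟨δ₂ / 4, by positivity, max (max M₁ M₂) 1, fun n M hM => ?_⟩
  have hM0 : 0 < M := lt_of_lt_of_le one_pos ((le_max_right _ _).trans hM)
  have hM' : (0 : ℝ) < M := Nat.cast_pos.2 hM0
  -- `e = ⌊δ M / (2 T)⌋` steps of the grid take a time between `δ / 4` and `δ / 2`
  have hfloor : ∀ {δ : ℝ}, 0 < δ → 2 * T / δ ≤ M →
      0 < ⌊δ * M / (2 * T)⌋₊ ∧ T * (2 * (⌊δ * M / (2 * T)⌋₊ : ℕ)) / M ≤ δ ∧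
      δ / 4 ≤ T * (⌊δ * M / (2 * T)⌋₊ : ℕ) / M := by
    intro δ hδ hδM
    have h1 : 1 ≤ δ * M / (2 * T) := by
      rw [le_div_iff₀ (by positivity)]
      linarith [(div_le_iff₀ hδ).1 hδM]
    have hle := Nat.floor_le (show 0 ≤ δ * M / (2 * T) by positivity)
    have hpos : 0 < ⌊δ * M / (2 * T)⌋₊ := Nat.floor_pos.2 h1
    have hlt := Nat.lt_floor_add_one (δ * M / (2 * T))
    have hpos' : (1 : ℝ) ≤ (⌊δ * M / (2 * T)⌋₊ : ℕ) := by exact_mod_cast hpos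
    refine ⟨hpos, ?_, ?_⟩
    · rw [div_le_iff₀ hM']
      rw [le_div_iff₀ (by positivity)] at hle
      linarith
    · rw [le_div_iff₀ hM']
      rw [div_lt_iff₀ (by positivity)] at hlt
      nlinarith
  have hMM₁ : 2 * T / δ₁ ≤ M := hM₁.trans (Nat.cast_le.2
    ((le_max_left _ _).trans ((le_max_left _ _).trans hM)))
  have hMM₂ : 2 * T / δ₂ ≤ M := hM₂.trans (Nat.cast_le.2
    ((le_max_right _ _).trans ((le_max_left _ _).trans hM)))
  obtain ⟨a₁, a₂, a₃⟩ := hfloor hδ₁ hMM₁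
  obtain ⟨b₁, b₂, b₃⟩ := hfloor hδ₂ hMM₂
  set e₁ := ⌊δ₁ * M / (2 * T)⌋₊
  set e₂ := ⌊δ₂ * M / (2 * T)⌋₊
  have hqe : 2 * M ≤ q * e₁ := by
    have h₃ : (2 : ℝ) * M ≤ q * e₁ := by
      rw [le_div_iff₀ hM'] at a₃
      rw [div_le_iff₀ hδ₁] at hq
      have h₄ : 8 * T * M ≤ q * (4 * (T * e₁)) := by
        calc 8 * T * M ≤ q * δ₁ * M := by gcongr
          _ = q * (4 * (δ₁ / 4 * M)) := by ring
          _ ≤ q * (4 * (T * e₁)) := by gcongr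
      have h₅ : T * (2 * M) ≤ T * (q * e₁) := by linarith
      exact le_of_mul_le_mul_left h₅ hT
    exact_mod_cast h₃
  have heM : e₂ ≤ M := by
    have h₃ : T * (2 * e₂) ≤ T * M := by
      rw [div_le_iff₀ hM'] at b₂
      exact b₂.trans (mul_le_mul_of_nonneg_right (min_le_right _ _) hM'.le)
    have h₄ : (2 : ℝ) * e₂ ≤ M := le_of_mul_le_mul_left h₃ hT
    have h₅ : 2 * e₂ ≤ M := by exact_mod_cast h₄
    omega
  refine (measure_mono ?_).trans ((measure_not_hasOscPartition_le (hX n) hη (h₁ n) (h₂ n) hM0 a₁ b₁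
    heM hqe a₂ b₂).trans (le_of_eq ?_))
  · exact fun ω hω h => hω (h.mono b₃)
  · have hq1 : ((q : ℝ≥0∞) + 1) = ENNReal.ofReal (q + 1) := by
      rw [ENNReal.ofReal_add (Nat.cast_nonneg _) zero_le_one]; simp
    have h16 : (16 : ℝ≥0∞) = ENNReal.ofReal 16 := by simp
    have h8 : (8 : ℝ≥0∞) = ENNReal.ofReal 8 := by simp
    rw [hq1, h16, h8, ← ENNReal.ofReal_mul (by positivity), ← ENNReal.ofReal_mul (by positivity),
      ← ENNReal.ofReal_mul (by positivity), ← ENNReal.ofReal_add (by positivity) (by positivity)]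
    congr 1
    field_simp
    ring

/-- Under the Aldous condition, the paths are close to their discretizations in probability,
uniformly over the processes. -/
lemma exists_measure_lt_edist_discretize_le {ι : Type*} (hT : 0 < T)
    {X : ι → Icc (0 : ℝ) T → Ω → E} (hX : ∀ n, StronglyAdapted 𝓕 (X n))
    (hA : ∀ ε : ℝ, 0 < ε → ∀ η : ℝ, 0 < η → ∃ δ : ℝ, 0 < δ ∧
      ∀ n, AldousBound hT P 𝓕 (X n) (ENNReal.ofReal ε) η δ)
    {W : ι → Ω → CadlagPath T E} (hW : ∀ n, ∀ᵐ ω ∂P, ∀ t, (W n ω).toFun t = X n t ω)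
    {ε η : ℝ} (hε : 0 < ε) (hη : 0 < η) :
    ∃ N : ℕ, ∀ n, P {ω | ENNReal.ofReal η < edist (W n ω) (discretize hT N (W n ω).toFun)}
      ≤ ENNReal.ofReal ε := by
  obtain ⟨δ, hδ, M₀, hM₀⟩ := exists_measure_not_hasOscPartition_le (P := P) hT hX hA hε
    (show 0 < η / 32 by positivity)
  obtain ⟨N₀, hN₀, hN⟩ := exists_forall_edist_discretize_le hT hδ
    (show 0 ≤ 8 * (η / 32) by positivity) (show 8 * (η / 32) < η / 2 by linarith)
  set N := max N₀ M₀
  have hNpos : 0 < N := hN₀.trans_le (le_max_left _ _)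
  refine ⟨N, fun n => ?_⟩
  -- bounds on arbitrarily fine grids `N (k + 1)` pass to the limit `k → ∞` by continuity of `P`
  let A : ℕ → Set Ω := fun K => ⋂ k ≥ K,
    {ω | ¬ HasOscPartition (discretize hT (N * (k + 1)) fun t => X n t ω).toFun δ (8 * (η / 32))}
  have hAmono : Monotone A := fun K K' hK ω hω => by
    simp only [A, mem_iInter] at hω ⊢
    exact fun k hk => hω k (hK.trans hk)
  have hsub : ∀ᵐ ω ∂P, ENNReal.ofReal η < edist (W n ω) (discretize hT N (W n ω).toFun) →
      ω ∈ ⋃ K, A K := by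
    filter_upwards [hW n] with ω hω hlt
    have hfun : (fun t => X n t ω) = (W n ω).toFun := funext fun t => (hω t).symm
    have hk : Tendsto (fun k : ℕ => N * (k + 1)) atTop atTop :=
      tendsto_atTop_mono (fun k => (Nat.le_succ k).trans (Nat.le_mul_of_pos_left _ hNpos))
        tendsto_id
    have hlim := EMetric.tendsto_nhds.1 ((tendsto_discretize hT (W n ω)).comp hk)
      (ENNReal.ofReal (η / 2)) (by simpa using hη)
    obtain ⟨K, hK⟩ := eventually_atTop.1 hlim
    refine mem_iUnion.2 ⟨K, mem_iInter₂.2 fun k hkK hosc => ?_⟩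
    have h₁ := hK k hkK
    rw [hfun] at hosc
    have h₂ := hN E _ hosc N (le_max_left _ _)
    rw [discretize_discretize hT hNpos k.succ_pos] at h₂
    refine hlt.not_ge ((edist_triangle _ (discretize hT (N * (k + 1)) (W n ω).toFun) _).trans ?_)
    rw [edist_comm] at h₁
    calc _ ≤ ENNReal.ofReal (η / 2) + ENNReal.ofReal (η / 2) := add_le_add h₁.le h₂
      _ = ENNReal.ofReal η := by
        rw [← ENNReal.ofReal_add (by positivity) (by positivity), add_halves]
  calc _ ≤ P (⋃ K, A K) := measure_mono_ae hsub
    _ = ⨆ K, P (A K) := hAmono.measure_iUnion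
    _ ≤ ENNReal.ofReal ε := iSup_le fun K => (measure_mono (biInter_subset_of_mem le_rfl)).trans
        (hM₀ n _ ((le_max_right N₀ M₀).trans (Nat.le_mul_of_pos_right _ K.succ_pos)))

end AldousUniform

/-! ### Bounded sets under compact and injective operators -/

section Operators

open ContinuousLinearMap InnerProductSpace

variable {E F : Type*} [NormedAddCommGroup E] [InnerProductSpace ℂ E] [CompleteSpace E]
  [NormedAddCommGroup F] [InnerProductSpace ℂ F] [CompleteSpace F]

/-- A bounded operator between Hilbert spaces maps closed balls to closed sets, because closed
balls are weakly compact. -/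
lemma isClosed_image_closedBall (ι : E →L[ℂ] F) (R : ℝ) :
    IsClosed (ι '' Metric.closedBall 0 R) := by
  let Ψ : WeakDual ℂ E → F → ℂ := fun g z => g (adjoint ι z)
  have hΨ : Continuous Ψ := continuous_pi fun z => WeakDual.eval_continuous _
  have hc : IsClosed (Ψ '' (WeakDual.toStrongDual ⁻¹' Metric.closedBall 0 R)) :=
    ((WeakDual.isCompact_closedBall (0 : StrongDual ℂ E) R).image hΨ).isClosed
  let Θ : F → F → ℂ := fun y z => inner ℂ y z
  have hΘ : Continuous Θ := continuous_pi fun z => continuous_id.inner continuous_const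
  convert hc.preimage hΘ using 1
  ext y
  constructor
  · rintro ⟨x, hx, rfl⟩
    refine ⟨StrongDual.toWeakDual (toDual ℂ E x), ?_, ?_⟩
    · simpa using hx
    · funext z
      change inner ℂ x (adjoint ι z) = inner ℂ (ι x) z
      rw [adjoint_inner_right]
  · rintro ⟨g, hg, hgy⟩
    obtain ⟨x, hx⟩ := (toDual ℂ E).surjective (WeakDual.toStrongDual g)
    refine ⟨x, ?_, ?_⟩
    · have : WeakDual.toStrongDual g ∈ Metric.closedBall (0 : StrongDual ℂ E) R := hg
      rw [← hx] at this
      simpa using this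
    · refine ext_inner_right ℂ fun z => ?_
      have h := congrFun hgy z
      change inner ℂ (ι x) z = inner ℂ y z
      rw [← adjoint_inner_right, ← toDual_apply_apply (𝕜 := ℂ), hx]
      exact h

/-- Along an injective operator with values in a Hilbert space, the functionals of the target are
dense in those of the source. -/
lemma exists_dual_comp_near {ι : E →L[ℂ] F} (hι : Function.Injective ι) (φ : StrongDual ℂ E)
    {ε : ℝ} (hε : 0 < ε) : ∃ ψ : StrongDual ℂ F, ‖φ - ψ.comp ι‖ ≤ ε := by
  obtain ⟨w, rfl⟩ := (toDual ℂ E).surjective φ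
  have hd : (adjoint ι).range.topologicalClosure = ⊤ := by
    rw [Submodule.topologicalClosure_eq_top_iff, orthogonal_range, adjoint_adjoint]
    exact LinearMap.ker_eq_bot.2 hι
  have hw : w ∈ closure (range (adjoint ι)) := by
    have : w ∈ (adjoint ι).range.topologicalClosure := hd ▸ Submodule.mem_top
    exact this
  obtain ⟨_, ⟨y, rfl⟩, hy⟩ := Metric.mem_closure_iff.1 hw ε hε
  refine ⟨toDual ℂ F y, ?_⟩
  have h : (toDual ℂ F y).comp ι = toDual ℂ E (adjoint ι y) := by
    ext x
    change inner ℂ y (ι x) = inner ℂ (adjoint ι y) x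
    rw [adjoint_inner_left]
  rw [h, ← map_sub, LinearIsometryEquiv.norm_map, ← dist_eq_norm]
  exact hy.le

end Operators

section Factor

/-- On a compact set, convergence can be tested after applying a continuous injective map. -/
lemma IsCompact.tendsto_of_injective {X Y α : Type*} [TopologicalSpace X] [TopologicalSpace Y]
    [T2Space Y] {K : Set X} (hK : IsCompact K) {κ : X → Y} (hκ : Continuous κ)
    (hinj : Function.Injective κ) {l : Filter α} {f : α → X} {x : X} (hf : ∀ a, f a ∈ K)
    (h : Tendsto (fun a => κ (f a)) l (𝓝 (κ x))) : Tendsto f l (𝓝 x) := by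
  refine hK.tendsto_nhds_of_unique_mapClusterPt (Eventually.of_forall hf) fun y _ hy => hinj ?_
  have h₁ : MapClusterPt (κ y) l (fun a => κ (f a)) := hy.continuousAt_comp hκ.continuousAt
  exact eq_of_nhds_neBot (h₁.neBot.mono (inf_le_inf_left _ h))

variable {E G F : Type*} [NormedAddCommGroup E] [NormedSpace ℂ E] [NormedAddCommGroup G]
  [NormedSpace ℂ G] [NormedAddCommGroup F] [NormedSpace ℂ F]

/-- If a compact operator `j` is followed by an injective operator `κ`, then a path that is bounded
in the first space and càdlàg in the last one is càdlàg in the middle one. -/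
lemma IsCadlag.of_compact_factor {T : ℝ} {j : E →ₗ[ℂ] G} (hj : IsCompactOperator j)
    {κ : G →L[ℂ] F} (hκ : Function.Injective κ) {u : Icc (0 : ℝ) T → E} {R : ℝ}
    (hR : ∀ t, ‖u t‖ ≤ R) (hu : IsCadlag fun t => κ (j (u t))) :
    IsCadlag fun t => j (u t) := by
  have hK := hj.isCompact_closure_image_closedBall R
  have hmem : ∀ t, j (u t) ∈ closure (j '' Metric.closedBall 0 R) := fun t =>
    subset_closure ⟨u t, by simpa using hR t, rfl⟩
  intro t
  refine ⟨hK.tendsto_of_injective κ.continuous hκ hmem (hu t).1, ?_⟩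
  rcases (𝓝[<] t).eq_or_neBot with hbot | hne
  · exact ⟨j (u t), by rw [hbot]; exact tendsto_bot⟩
  obtain ⟨l, hl⟩ := (hu t).2
  obtain ⟨x, -, rfl⟩ : l ∈ κ '' closure (j '' Metric.closedBall 0 R) :=
    (hK.image κ.continuous).isClosed.mem_of_tendsto hl
      (Eventually.of_forall fun s => mem_image_of_mem κ (hmem s))
  exact ⟨x, hK.tendsto_of_injective κ.continuous hκ hmem hl⟩

end Factor

/-! ### The energy space -/

namespace NonnegSelfAdjointOp

section Hilbert

variable {H : Type*} [NormedAddCommGroup H] [InnerProductSpace ℂ H] [CompleteSpace H]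
  (A : NonnegSelfAdjointOp H)

lemma norm_energySqrt (x : A.EnergySpace) : ‖A.energySqrt x‖ = ‖x‖ := rfl

lemma invSqrt_energySqrt (x : A.EnergySpace) : A.invSqrt (A.energySqrt x) = A.energyToH x :=
  A.invSqrt_sqrtOneAdd x

lemma energySqrt_surjective : Function.Surjective A.energySqrt := fun y => by
  have hmem : A.invSqrt y ∈ A.sqrtOneAdd.domain := (A.mem_domain_sqrtOneAdd _).2 ⟨y, rfl⟩
  refine ⟨(⟨A.invSqrt y, hmem⟩ : A.sqrtOneAdd.domain), A.invSqrt_injective ?_⟩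
  exact A.invSqrt_sqrtOneAdd ⟨A.invSqrt y, hmem⟩

/-- `(Id + A)^{1/2}` as an isometry of the energy space onto `H`. -/
def energyIsometry : A.EnergySpace ≃ₗᵢ[ℂ] H :=
  LinearIsometryEquiv.ofSurjective ⟨A.energySqrt, A.norm_energySqrt⟩ A.energySqrt_surjective

instance : CompleteSpace A.EnergySpace :=
  (completeSpace_congr (e := A.energyIsometry.toEquiv)
    A.energyIsometry.isometry.isUniformEmbedding).2 inferInstance

/-- The inclusion of `H` into the dual energy space. -/
def toDualCLM : H →L[ℂ] A.DualEnergySpace :=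
  ((UniformSpace.Completion.toComplₗᵢ (𝕜 := ℂ) (E := A.PreDual)).toLinearMap ∘ₗ
    A.toPreDual).mkContinuous ‖A.invSqrt‖ fun x => by
      rw [LinearMap.comp_apply, LinearIsometry.coe_toLinearMap, LinearIsometry.norm_map]
      exact A.invSqrt.le_opNorm x

lemma toDualCLM_energyToH (x : A.EnergySpace) : A.toDualCLM (A.energyToH x) = A.energyToDual x :=
  rfl

lemma toDualCLM_injective : Function.Injective A.toDualCLM := fun _ _ h =>
  UniformSpace.Completion.coe_injective A.PreDual h

lemma energyToH_injective : Function.Injective A.energyToH := Subtype.val_injective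

/-- The embedding of the energy space into its dual as a bounded operator. -/
def energyToDualCLM : A.EnergySpace →L[ℂ] A.DualEnergySpace :=
  A.energyToDual.mkContinuous (‖A.toDualCLM‖ * ‖A.invSqrt‖) fun x => by
    rw [← toDualCLM_energyToH, ← invSqrt_energySqrt, mul_assoc, ← A.norm_energySqrt x]
    exact (A.toDualCLM.le_opNorm _).trans
      (mul_le_mul_of_nonneg_left (A.invSqrt.le_opNorm _) (norm_nonneg _))

lemma energyToDualCLM_apply (x : A.EnergySpace) : A.energyToDualCLM x = A.energyToDual x := rfl

lemma energyToDualCLM_injective : Function.Injective A.energyToDualCLM :=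
  A.toDualCLM_injective.comp A.energyToH_injective

lemma energyENorm_energyToDual (x : A.EnergySpace) : A.energyENorm (A.energyToDual x) = ‖x‖ₑ := by
  refine le_antisymm (iInf₂_le (f := fun z (_ : A.energyToDual z = A.energyToDual x) => ‖z‖ₑ)
    x rfl) (le_iInf₂ fun y hy => ?_)
  rw [A.energyToDualCLM_injective hy]

lemma energyENorm_le_iff {y : A.DualEnergySpace} {R : ℝ} (hR : 0 ≤ R) :
    A.energyENorm y ≤ ENNReal.ofReal R ↔ ∃ x, ‖x‖ ≤ R ∧ A.energyToDual x = y := by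
  constructor
  · intro h
    have hlt : A.energyENorm y < ∞ := h.trans_lt ENNReal.ofReal_lt_top
    obtain ⟨x, hx⟩ := iInf_lt_iff.1 hlt
    obtain ⟨hxy, -⟩ := iInf_lt_iff.1 hx
    refine ⟨x, ?_, hxy⟩
    rw [← hxy, energyENorm_energyToDual, ← ofReal_norm, ENNReal.ofReal_le_ofReal_iff hR] at h
    exact h
  · rintro ⟨x, hx, rfl⟩
    rw [energyENorm_energyToDual, ← ofReal_norm]
    exact ENNReal.ofReal_le_ofReal hx

/-- Closed balls of the energy space are closed in its dual, so the extended energy norm is lower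
semicontinuous. -/
lemma lowerSemicontinuous_energyENorm : LowerSemicontinuous A.energyENorm := by
  refine lowerSemicontinuous_iff_isClosed_preimage.2 fun c => ?_
  rcases eq_or_ne c ∞ with rfl | hc
  · simp
  have h : A.energyENorm ⁻¹' Iic c = A.energyToDualCLM '' Metric.closedBall 0 c.toReal := by
    ext y
    rw [mem_preimage, mem_Iic, ← ENNReal.ofReal_toReal hc, A.energyENorm_le_iff
      ENNReal.toReal_nonneg, ENNReal.toReal_ofReal ENNReal.toReal_nonneg]
    simp only [mem_image, mem_closedBall_zero_iff, energyToDualCLM_apply]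
  rw [h]
  exact isClosed_image_closedBall _ _

end Hilbert

section Lebesgue

variable {M : Type*} [MeasurableSpace M] {μ : Measure M} [IsFiniteMeasure μ]

/-- The inclusion of `L^p(M)` into `L²(M)` for `p ≥ 2` and a finite measure. -/
def lpToL2 {p : ℝ≥0∞} [Fact (1 ≤ p)] (hp2 : 2 ≤ p) : Lp ℂ p μ →L[ℂ] Lp ℂ 2 μ :=
  LinearMap.mkContinuous
    { toFun := fun f => ((Lp.memLp f).mono_exponent hp2).toLp
      map_add' := fun f g => by
        rw [← MemLp.toLp_add, MemLp.toLp_eq_toLp_iff]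
        exact Lp.coeFn_add _ _
      map_smul' := fun c f => by
        rw [RingHom.id_apply, ← MemLp.toLp_const_smul, MemLp.toLp_eq_toLp_iff]
        exact Lp.coeFn_smul _ _ }
    ((μ univ ^ (1 / (2 : ℝ≥0∞).toReal - 1 / p.toReal)).toReal) fun f => by
      change ‖((Lp.memLp f).mono_exponent hp2).toLp‖ ≤ _
      rw [Lp.norm_toLp, Lp.norm_def, mul_comm, ← ENNReal.toReal_mul]
      refine ENNReal.toReal_mono (ENNReal.mul_ne_top (Lp.eLpNorm_ne_top f) ?_)
        (eLpNorm_le_eLpNorm_mul_rpow_measure_univ hp2 (Lp.aestronglyMeasurable f))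
      refine ENNReal.rpow_ne_top_of_nonneg ?_ (measure_ne_top _ _)
      rcases eq_or_ne p ∞ with rfl | hp
      · simp
      · rw [sub_nonneg]
        refine one_div_le_one_div_of_le (by simp) (ENNReal.toReal_mono hp hp2)

lemma lpToL2_injective {p : ℝ≥0∞} [Fact (1 ≤ p)] (hp2 : 2 ≤ p) :
    Function.Injective (lpToL2 hp2 : Lp ℂ p μ →L[ℂ] Lp ℂ 2 μ) := fun f g h => by
  have h' : ((Lp.memLp f).mono_exponent hp2).toLp = ((Lp.memLp g).mono_exponent hp2).toLp := h
  exact Lp.ext ((MemLp.toLp_eq_toLp_iff _ _).1 h')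

variable (A : NonnegSelfAdjointOp (Lp ℂ 2 μ))

/-- The inclusion of `L^p(M)` into the dual energy space, for `p ≥ 2`. -/
def lpToDual {p : ℝ≥0∞} [Fact (1 ≤ p)] (hp2 : 2 ≤ p) : Lp ℂ p μ →L[ℂ] A.DualEnergySpace :=
  A.toDualCLM ∘L lpToL2 hp2

lemma lpToDual_injective {p : ℝ≥0∞} [Fact (1 ≤ p)] (hp2 : 2 ≤ p) :
    Function.Injective (A.lpToDual hp2) :=
  A.toDualCLM_injective.comp (lpToL2_injective hp2)

variable {A}

lemma lpToDual_incl {p : ℝ≥0∞} [Fact (1 ≤ p)] (hp2 : 2 ≤ p) (hp : A.EnergySubsetLp p)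
    (x : A.EnergySpace) : A.lpToDual hp2 (hp.incl x) = A.energyToDual x := by
  rw [← toDualCLM_energyToH]
  refine congrArg A.toDualCLM (Lp.ext ?_)
  exact (MemLp.coeFn_toLp _).trans (MemLp.coeFn_toLp (hp x))

end Lebesgue

end NonnegSelfAdjointOp

/-! ### Convergence in the Skorokhod space -/

section SkorokhodConvergence

variable {T : ℝ} {S S' : Type*}

/-- Maps that are Lipschitz up to an additive error act on Skorokhod distances in the same way. -/
lemma CadlagPath.edist_le_add_mul [PseudoEMetricSpace S] [PseudoEMetricSpace S']
    {u v : CadlagPath T S} {u' v' : CadlagPath T S'} {d C : ℝ≥0∞} (hC : 1 ≤ C) (hC' : C ≠ ∞)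
    (h : ∀ s t, edist (u'.toFun s) (v'.toFun t) ≤ d + C * edist (u.toFun s) (v.toFun t)) :
    edist u' v' ≤ d + C * edist u v := by
  change _ ≤ d + C * ⨅ l, Skorokhod.cost u.toFun v.toFun l
  rw [ENNReal.mul_iInf_of_ne (zero_lt_one.trans_le hC).ne' hC', ENNReal.add_iInf]
  refine le_iInf fun l => (u'.edist_le_cost v' l).trans ?_
  have hmul : ∀ x : ℝ≥0∞, x ≤ C * x := fun x => le_mul_of_one_le_left' hC
  have h₁ : (⨆ t, edist (u'.toFun t) (v'.toFun (l t)))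
      ≤ d + C * ⨆ t, edist (u.toFun t) (v.toFun (l t)) := iSup_le fun t => (h t (l t)).trans
    (by gcongr; exact le_iSup (fun t => edist (u.toFun t) (v.toFun (l t))) t)
  refine (add_le_add (add_le_add h₁ (hmul _)) (hmul _)).trans (le_of_eq ?_)
  simp only [Skorokhod.cost]
  ring

/-- Skorokhod convergence implies convergence at the continuity points of the limit. -/
lemma CadlagPath.tendsto_apply [PseudoEMetricSpace S] {α : Type*} {l : Filter α}
    {u : α → CadlagPath T S} {v : CadlagPath T S} (h : Tendsto u l (𝓝 v)) {t : Icc (0 : ℝ) T}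
    (ht : ContinuousAt v.toFun t) : Tendsto (fun a => (u a).toFun t) l (𝓝 (v.toFun t)) := by
  refine EMetric.tendsto_nhds.2 fun ε hε => ?_
  obtain ⟨δ, hδ, hδε⟩ := EMetric.mem_nhds_iff.1
    (EMetric.tendsto_nhds.1 ht (ε / 2) (ENNReal.half_pos hε.ne'))
  filter_upwards [EMetric.tendsto_nhds.1 h (min δ (ε / 2))
    (lt_min hδ (ENNReal.half_pos hε.ne'))] with a ha
  obtain ⟨m, hm⟩ := CadlagPath.exists_cost_lt ha
  have h₁ : edist ((u a).toFun t) (v.toFun (m t)) < ε / 2 :=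
    ((le_iSup (fun t => edist ((u a).toFun t) (v.toFun (m t))) t).trans
      (le_self_add.trans le_self_add)).trans_lt (hm.trans_le (min_le_right _ _))
  have h₂ : edist t (m t) < δ :=
    ((le_iSup (fun t => edist t (m t)) t).trans
      (le_add_self.trans le_self_add)).trans_lt (hm.trans_le (min_le_left _ _))
  have h₃ : edist (v.toFun (m t)) (v.toFun t) < ε / 2 := hδε (by
    rw [Metric.mem_eball, edist_comm]; exact h₂)
  calc _ ≤ edist ((u a).toFun t) (v.toFun (m t)) + edist (v.toFun (m t)) (v.toFun t) :=
        edist_triangle _ _ _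
    _ < ε / 2 + ε / 2 := ENNReal.add_lt_add h₁ h₃
    _ = ε := ENNReal.add_halves ε

/-- The set of paths with values in a closed set is closed. -/
lemma CadlagPath.isClosed_forall_mem [PseudoEMetricSpace S] {L : Set S} (hL : IsClosed L) :
    IsClosed {v : CadlagPath T S | ∀ t, v.toFun t ∈ L} := by
  refine isClosed_of_closure_subset fun v hv t => ?_
  rw [← hL.closure_eq, EMetric.mem_closure_iff]
  intro ε hε
  obtain ⟨w, hw, hvw⟩ := EMetric.mem_closure_iff.1 hv ε hε
  obtain ⟨m, hm⟩ := CadlagPath.exists_cost_lt hvw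
  exact ⟨w.toFun (m t), hw (m t), ((le_iSup (fun t => edist (v.toFun t) (w.toFun (m t))) t).trans
    (le_self_add.trans le_self_add)).trans_lt hm⟩

end SkorokhodConvergence

/-! ### Bounded parts of the path space -/

instance (T : ℝ) : IsFiniteMeasure (timeMeasure T) := by
  refine ⟨?_⟩
  rw [timeMeasure, comap_subtype_coe_apply measurableSet_Icc]
  exact (measure_mono (Subtype.coe_image_subset _ _)).trans_lt measure_Icc_lt_top

lemma timeMeasure_eq_zero_of_countable {T : ℝ} {s : Set (Icc (0 : ℝ) T)} (hs : s.Countable) :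
    timeMeasure T s = 0 := by
  rw [timeMeasure, comap_subtype_coe_apply measurableSet_Icc]
  exact (hs.image _).measure_zero _

/-- Dominated convergence in `L^p` of a finite measure, for uniformly bounded functions. -/
lemma tendsto_toLp_of_bounded {α β G : Type*} {mα : MeasurableSpace α} {ν : Measure α}
    [IsFiniteMeasure ν] [NormedAddCommGroup G] {p : ℝ≥0∞} [Fact (1 ≤ p)] (hp : p ≠ ∞)
    {l : Filter β} [l.IsCountablyGenerated] {f : β → α → G} {g : α → G}
    (hf : ∀ b, MemLp (f b) p ν) (hg : MemLp g p ν) {C : ℝ} (hC : ∀ b x, ‖f b x - g x‖ ≤ C)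
    (h : ∀ᵐ x ∂ν, Tendsto (fun b => f b x) l (𝓝 (g x))) :
    Tendsto (fun b => (hf b).toLp) l (𝓝 hg.toLp) := by
  have hp0 : p ≠ 0 := (zero_lt_one.trans_le (Fact.out : 1 ≤ p)).ne'
  have hp0' : 0 < p.toReal := ENNReal.toReal_pos hp0 hp
  rw [Lp.tendsto_Lp_iff_tendsto_eLpNorm'']
  simp only [eLpNorm_eq_lintegral_rpow_enorm_toReal hp0 hp]
  have hlim : Tendsto (fun b => ∫⁻ x, ‖(f b - g) x‖ₑ ^ p.toReal ∂ν) l (𝓝 (∫⁻ _, 0 ∂ν)) := by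
    refine tendsto_lintegral_filter_of_dominated_convergence'
      (fun _ => ENNReal.ofReal C ^ p.toReal) (Eventually.of_forall fun b => ?_)
      (Eventually.of_forall fun b => Eventually.of_forall fun x => ?_) ?_ ?_
    · exact ((hf b).1.sub hg.1).enorm.pow_const _
    · refine ENNReal.rpow_le_rpow ?_ hp0'.le
      rw [Pi.sub_apply, ← ofReal_norm]
      exact ENNReal.ofReal_le_ofReal (hC b x)
    · rw [lintegral_const]
      exact ENNReal.mul_ne_top (ENNReal.rpow_ne_top_of_nonneg hp0'.le ENNReal.ofReal_ne_top)
        (measure_ne_top _ _)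
    · filter_upwards [h] with x hx
      have h₁ : Tendsto (fun b => ‖(f b - g) x‖ₑ) l (𝓝 0) := by
        have := (hx.sub_const (g x)).enorm
        simpa using this
      have := (ENNReal.continuous_rpow_const (y := p.toReal)).tendsto 0 |>.comp h₁
      rw [ENNReal.zero_rpow_of_pos hp0'] at this
      exact this
  rw [lintegral_zero] at hlim
  have := (ENNReal.continuous_rpow_const (y := 1 / p.toReal)).tendsto 0 |>.comp hlim
  rw [ENNReal.zero_rpow_of_pos (by positivity)] at this
  exact this

namespace EnergyPath

variable {M : Type*} [MeasurableSpace M] {μ : Measure M}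
  {A : NonnegSelfAdjointOp (Lp ℂ 2 μ)} {p : ℝ≥0∞} [Fact (1 ≤ p)] {hp : A.EnergySubsetLp p} {T : ℝ}

open NonnegSelfAdjointOp

/-- A càdlàg path in `E_A^*` with values in a ball of `E_A` belongs to the path space `Z_T`. -/
lemma exists_of_bounded [IsFiniteMeasure μ] (hT : 0 < T) (hp2 : 2 ≤ p)
    (hcompact : IsCompactOperator hp.incl)
    {v : Icc (0 : ℝ) T → A.DualEnergySpace} (hv : IsCadlag v) {R : ℝ} (hR : 0 ≤ R)
    (hvR : ∀ t, A.energyENorm (v t) ≤ ENNReal.ofReal R) :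
    ∃ u : EnergyPath A hp T, (∀ t, ‖u.toFun t‖ ≤ R) ∧ ∀ t, A.energyToDual (u.toFun t) = v t := by
  choose u huR huv using fun t => (A.energyENorm_le_iff hR).1 (hvR t)
  have hu : IsCadlag fun t => A.energyToDual (u t) := by simpa only [huv] using hv
  let j : A.EnergySpace →L[ℂ] Lp ℂ p μ := ⟨hp.incl, hcompact.continuous⟩
  have hinc : IsCadlag fun t => hp.incl (u t) := by
    refine IsCadlag.of_compact_factor hcompact (A.lpToDual_injective hp2) huR ?_
    simpa only [lpToDual_incl] using hu
  refine ⟨⟨u, hu, ?_, fun φ => ?_⟩, huR, huv⟩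
  · refine MemLp.of_bound (hinc.stronglyMeasurable hT).aestronglyMeasurable (‖j‖ * R)
      (Eventually.of_forall fun t => ?_)
    exact (j.le_opNorm (u t)).trans (mul_le_mul_of_nonneg_left (huR t) (norm_nonneg j))
  · refine isCadlag_of_approx fun ε hε => ?_
    obtain ⟨ψ, hψ⟩ := exists_dual_comp_near A.energyToDualCLM_injective φ
      (show 0 < ε / (R + 1) by positivity)
    refine ⟨fun t => ψ (A.energyToDual (u t)), hu.continuous_comp ψ.continuous, fun t => ?_⟩
    calc dist (φ (u t)) (ψ (A.energyToDual (u t))) = ‖(φ - ψ.comp A.energyToDualCLM) (u t)‖ :=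
          dist_eq_norm _ _
      _ ≤ ‖φ - ψ.comp A.energyToDualCLM‖ * ‖u t‖ := ContinuousLinearMap.le_opNorm _ _
      _ ≤ ε / (R + 1) * (R + 1) := by
        gcongr
        linarith [huR t]
      _ = ε := by field_simp

/-- On bounded sets of `E_A`, testing against a functional is continuous for the Skorokhod metric
of `E_A^*`. -/
lemma tendsto_dual_apply {β : Type*} {l : Filter β} {w : β → EnergyPath A hp T}
    {u : EnergyPath A hp T} {R : ℝ} (hw : ∀ b t, ‖(w b).toFun t‖ ≤ R) (hu : ∀ t, ‖u.toFun t‖ ≤ R)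
    (h : Tendsto (fun b => (w b).toCadlag) l (𝓝 u.toCadlag)) (φ : StrongDual ℂ A.EnergySpace) :
    Tendsto (fun b => (⟨fun t => φ ((w b).toFun t), (w b).isCadlag_weak φ⟩ : CadlagPath T ℂ)) l
      (𝓝 ⟨fun t => φ (u.toFun t), u.isCadlag_weak φ⟩) := by
  refine EMetric.tendsto_nhds.2 fun ε hε => ?_
  obtain ⟨r, hr0, hrε⟩ := ENNReal.lt_iff_exists_nnreal_btwn.1 hε
  have hr : (0 : ℝ) < r := by exact_mod_cast hr0
  obtain ⟨ψ, hψ⟩ := exists_dual_comp_near A.energyToDualCLM_injective φ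
    (show 0 < r / (2 * (|R| + 1)) by positivity)
  set C : ℝ≥0∞ := 1 + ‖ψ‖ₑ
  have hC' : C ≠ ∞ := by simp [C]
  have hbound : ∀ b, edist (⟨fun t => φ ((w b).toFun t), (w b).isCadlag_weak φ⟩ : CadlagPath T ℂ)
      ⟨fun t => φ (u.toFun t), u.isCadlag_weak φ⟩
      ≤ ENNReal.ofReal r + C * edist (w b).toCadlag u.toCadlag := by
    intro b
    refine CadlagPath.edist_le_add_mul le_self_add hC' fun s t => ?_
    change edist (φ ((w b).toFun s)) (φ (u.toFun t)) ≤ ENNReal.ofReal r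
      + C * edist (A.energyToDual ((w b).toFun s)) (A.energyToDual (u.toFun t))
    set x := (w b).toFun s
    set y := u.toFun t
    have e : φ x - φ y = (φ - ψ.comp A.energyToDualCLM) (x - y)
        + ψ (A.energyToDual x - A.energyToDual y) := by
      rw [← map_sub, ← map_sub]
      change _ = (φ (x - y) - ψ (A.energyToDual (x - y))) + ψ (A.energyToDual (x - y))
      ring
    rw [edist_eq_enorm_sub, edist_eq_enorm_sub, e]
    refine (enorm_add_le _ _).trans (add_le_add ?_ ?_)
    · rw [← ofReal_norm]
      refine ENNReal.ofReal_le_ofReal ?_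
      calc _ ≤ ‖φ - ψ.comp A.energyToDualCLM‖ * ‖x - y‖ := ContinuousLinearMap.le_opNorm _ _
        _ ≤ r / (2 * (|R| + 1)) * (2 * (|R| + 1)) := by
          gcongr
          have := norm_sub_le x y
          have := hw b s
          have := hu t
          have := le_abs_self R
          linarith
        _ = r := by field_simp
    · exact (ψ.le_opENorm _).trans (mul_le_mul' le_add_self le_rfl)
  have hlim : Tendsto (fun b => ENNReal.ofReal r + C * edist (w b).toCadlag u.toCadlag) l
      (𝓝 (ENNReal.ofReal r)) := by
    have h₀ : Tendsto (fun b => edist (w b).toCadlag u.toCadlag) l (𝓝 0) := by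
      have := h.edist (tendsto_const_nhds (x := u.toCadlag))
      rwa [edist_self] at this
    simpa using (ENNReal.Tendsto.const_mul h₀ (Or.inr hC')).const_add (ENNReal.ofReal r)
  have hlt : ENNReal.ofReal r < ε := by rwa [ENNReal.ofReal_coe_nnreal]
  filter_upwards [hlim.eventually_lt_const hlt] with b hb
  exact (hbound b).trans_lt hb

/-- On bounded sets of `E_A`, the inclusion into `L^p(0,T; L^p(M))` is continuous for the Skorokhod
metric of `E_A^*`: the compact embedding turns convergence in `E_A^*` at almost all times
into convergence in `L^p(M)`. -/
lemma tendsto_toLp [IsFiniteMeasure μ] (hp2 : 2 ≤ p) (hp_top : p ≠ ∞)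
    (hcompact : IsCompactOperator hp.incl)
    {β : Type*} {l : Filter β} [l.IsCountablyGenerated] {w : β → EnergyPath A hp T}
    {u : EnergyPath A hp T} {R : ℝ} (hw : ∀ b t, ‖(w b).toFun t‖ ≤ R) (hu : ∀ t, ‖u.toFun t‖ ≤ R)
    (h : Tendsto (fun b => (w b).toCadlag) l (𝓝 u.toCadlag)) :
    Tendsto (fun b => (w b).toLp) l (𝓝 u.toLp) := by
  let j : A.EnergySpace →L[ℂ] Lp ℂ p μ := ⟨hp.incl, hcompact.continuous⟩
  refine tendsto_toLp_of_bounded hp_top _ _ (C := ‖j‖ * (2 * R)) (fun b t => ?_) ?_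
  · rw [← map_sub]
    refine (j.le_opNorm _).trans (mul_le_mul_of_nonneg_left ?_ (norm_nonneg j))
    have := norm_sub_le ((w b).toFun t) (u.toFun t)
    have := hw b t
    have := hu t
    linarith
  · have hae : ∀ᵐ t ∂timeMeasure T, ContinuousAt u.toCadlag.toFun t :=
      timeMeasure_eq_zero_of_countable u.toCadlag.isCadlag.countable_not_continuousAt
    filter_upwards [hae] with t ht
    refine (hcompact.isCompact_closure_image_closedBall R).tendsto_of_injective
      (A.lpToDual hp2).continuous (A.lpToDual_injective hp2)
      (fun b => subset_closure ⟨_, by simpa using hw b t, rfl⟩) ?_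
    simp only [lpToDual_incl]
    exact CadlagPath.tendsto_apply h ht

variable (A hp T) in
/-- The paths of `Z_T` with values in the ball of radius `R` of `E_A`. -/
def ball (R : ℝ) : Set (EnergyPath A hp T) := {u | ∀ t, ‖u.toFun t‖ ≤ R}

lemma continuous_toCadlag : Continuous (toCadlag : EnergyPath A hp T → _) :=
  continuous_iff_le_induced.2 (inf_le_left.trans inf_le_left)

/-- On paths with values in a ball of `E_A`, the topology of `Z_T` is that of the Skorokhod metric
of `E_A^*`. -/
lemma isInducing_toCadlag [IsFiniteMeasure μ] (hp2 : 2 ≤ p) (hp_top : p ≠ ∞)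
    (hcompact : IsCompactOperator hp.incl)
    (R : ℝ) : IsInducing fun u : ball A hp T R => toCadlag u.1 := by
  refine isInducing_iff_nhds.2 fun u => le_antisymm
    ((continuous_toCadlag.comp continuous_subtype_val).tendsto u).le_comap ?_
  set l := comap (fun u : ball A hp T R => toCadlag u.1) (𝓝 (toCadlag u.1))
  have h : Tendsto (fun w : ball A hp T R => toCadlag w.1) l (𝓝 (toCadlag u.1)) := tendsto_comap
  have key : Tendsto (fun w : ball A hp T R => w.1) l (𝓝 u.1) := by
    have hnhds : 𝓝 u.1 = comap toCadlag (𝓝 u.1.toCadlag) ⊓ comap toLp (𝓝 u.1.toLp)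
        ⊓ comap toWeaklyCadlag (𝓝 u.1.toWeaklyCadlag) := by
      rw [← nhds_induced, ← nhds_induced, ← nhds_induced, ← nhds_inf, ← nhds_inf]
    have hweak : Tendsto (fun w : ball A hp T R => w.1.toWeaklyCadlag) l
        (𝓝 u.1.toWeaklyCadlag) := by
      rw [nhds_iInf, tendsto_iInf]
      intro φ
      rw [nhds_induced, tendsto_comap_iff]
      exact tendsto_dual_apply (fun w => w.2) u.2 h φ
    rw [hnhds]
    exact tendsto_inf.2 ⟨tendsto_inf.2 ⟨tendsto_comap_iff.2 h,
      tendsto_comap_iff.2 (tendsto_toLp hp2 hp_top hcompact (fun w => w.2) u.2 h)⟩,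
      tendsto_comap_iff.2 hweak⟩
  rw [nhds_subtype_eq_comap]
  exact key.le_comap

lemma mem_ball_iff {R : ℝ} (hR : 0 ≤ R) {u : EnergyPath A hp T} :
    u ∈ ball A hp T R ↔ ∀ t, A.energyENorm (u.toCadlag.toFun t) ≤ ENNReal.ofReal R := by
  refine forall_congr' fun t => ?_
  change _ ↔ A.energyENorm (A.energyToDual (u.toFun t)) ≤ _
  rw [energyENorm_energyToDual, ← ofReal_norm, ENNReal.ofReal_le_ofReal_iff hR]

variable (A T) in
lemma isClosed_energyENorm_le (c : ℝ≥0∞) :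
    IsClosed {v : CadlagPath T A.DualEnergySpace | ∀ t, A.energyENorm (v.toFun t) ≤ c} :=
  CadlagPath.isClosed_forall_mem (A.lowerSemicontinuous_energyENorm.isClosed_preimage c)

/-- Preimages of compact sets of bounded paths are compact in `Z_T`. -/
lemma isCompact_preimage_toCadlag [IsFiniteMeasure μ] (hT : 0 < T) (hp2 : 2 ≤ p)
    (hp_top : p ≠ ∞)
    (hcompact : IsCompactOperator hp.incl) {R : ℝ} (hR : 0 ≤ R)
    {𝒦 : Set (CadlagPath T A.DualEnergySpace)} (h𝒦 : IsCompact 𝒦)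
    (hbdd : ∀ v ∈ 𝒦, ∀ t, A.energyENorm (v.toFun t) ≤ ENNReal.ofReal R) :
    IsCompact (toCadlag ⁻¹' 𝒦 : Set (EnergyPath A hp T)) := by
  have h := (isInducing_toCadlag (T := T) hp2 hp_top hcompact R).isCompact_preimage' h𝒦
    fun v hv => by
      obtain ⟨u, hu, huv⟩ := exists_of_bounded hT hp2 hcompact v.isCadlag hR (hbdd v hv)
      refine ⟨⟨u, hu⟩, ?_⟩
      rcases v with ⟨v, hv⟩
      exact CadlagPath.mk.injEq _ _ _ _ |>.mpr (funext huv)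
  convert h.image continuous_subtype_val using 1
  ext u
  constructor
  · intro hu
    exact ⟨⟨u, (mem_ball_iff hR).2 (hbdd _ hu)⟩, hu, rfl⟩
  · rintro ⟨u, hu, rfl⟩
    exact hu

/-- A random path in `Z_T` is measurable as soon as it is a random element of the Skorokhod space
of `E_A^*`: on each of the sets `ball A hp T R`, whose union contains all the values, both
spaces have the same open sets. -/
lemma measurable_of_toCadlag [IsFiniteMeasure μ] (hp2 : 2 ≤ p) (hp_top : p ≠ ∞)
    (hcompact : IsCompactOperator hp.incl) {Ω : Type*} {mΩ : MeasurableSpace Ω}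
    {Y : Ω → EnergyPath A hp T} (hbdd : ∀ ω, ∃ R : ℝ, ∀ t, ‖(Y ω).toFun t‖ ≤ R)
    (hY : StronglyMeasurable fun ω => (Y ω).toCadlag) : Measurable Y := by
  refine measurable_generateFrom fun O (hO : IsOpen O) => ?_
  borelize (CadlagPath T A.DualEnergySpace)
  have hunion : Y ⁻¹' O = ⋃ R : ℕ, {ω | Y ω ∈ ball A hp T R ∧ Y ω ∈ O} := by
    ext ω
    simp only [mem_preimage, mem_iUnion, mem_ofPred_eq, exists_and_right]
    refine ⟨fun h => ⟨?_, h⟩, fun h => h.2⟩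
    obtain ⟨R, hR⟩ := hbdd ω
    obtain ⟨n, hn⟩ := exists_nat_ge R
    exact ⟨n, fun t => (hR t).trans hn⟩
  rw [hunion]
  refine MeasurableSet.iUnion fun R => ?_
  obtain ⟨G, hG, hGO⟩ := (isInducing_toCadlag (A := A) (hp := hp) (T := T) hp2 hp_top hcompact
    R).isOpen_iff.1 (hO.preimage continuous_subtype_val)
  have hset : {ω | Y ω ∈ ball A hp T R ∧ Y ω ∈ O} = (fun ω => (Y ω).toCadlag) ⁻¹'
      ({v | ∀ t, A.energyENorm (v.toFun t) ≤ ENNReal.ofReal R} ∩ G) := by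
    ext ω
    rw [mem_preimage, mem_inter_iff, mem_ofPred_eq, mem_ofPred_eq,
      ← mem_ball_iff (Nat.cast_nonneg R)]
    refine and_congr_right fun h => ?_
    exact (Set.ext_iff.1 hGO ⟨Y ω, h⟩).symm
  rw [hset]
  exact hY.measurable ((isClosed_energyENorm_le A T _).measurableSet.inter hG.measurableSet)

end EnergyPath

/-! ### Tightness -/

section Tightness

variable {H : Type*} [NormedAddCommGroup H] [InnerProductSpace ℂ H] [CompleteSpace H]
  {T : ℝ} {Ω : Type*} {mΩ : MeasurableSpace Ω} {P : Measure Ω}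

/-- The uncountable supremum is measurable since, along càdlàg paths, it agrees with the one over a
countable set of times. -/
lemma aemeasurable_iSup_energyENorm_sq (A : NonnegSelfAdjointOp H) (hT : 0 < T)
    {X : Icc (0 : ℝ) T → Ω → A.DualEnergySpace} (hX : ∀ t, StronglyMeasurable (X t))
    (hcadlag : ∀ᵐ ω ∂P, IsCadlag fun t => X t ω) :
    AEMeasurable (fun ω => ⨆ t, A.energyENorm (X t ω) ^ 2) P := by
  have hlsc : LowerSemicontinuous fun y => A.energyENorm y ^ 2 :=
    (ENNReal.continuous_pow 2).comp_lowerSemicontinuous A.lowerSemicontinuous_energyENorm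
      fun a b hab => pow_le_pow_left' hab 2
  refine ⟨fun ω => ⨆ (N : ℕ) (i : ℕ), A.energyENorm (X (gridPoint hT N i) ω) ^ 2, ?_, ?_⟩
  · borelize A.DualEnergySpace
    exact Measurable.iSup fun N => Measurable.iSup fun i =>
      hlsc.measurable.comp (hX (gridPoint hT N i)).measurable
  · filter_upwards [hcadlag] with ω hω
    exact iSup_comp_eq_iSup_grid hT hlsc hω

/-- The condition of Aldous and the energy bound put the paths, up to small probability, in one
relatively compact set of the Skorokhod space of `E_A^*` on which the energy is bounded. -/
lemma exists_compact_of_aldous (A : NonnegSelfAdjointOp H) (hT : 0 < T)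
    {𝓕 : Filtration (Icc (0 : ℝ) T) mΩ} {ι : Type*} {X : ι → Icc (0 : ℝ) T → Ω → A.DualEnergySpace}
    (hX : ∀ n, StronglyAdapted 𝓕 (X n))
    (hA : ∀ ε : ℝ, 0 < ε → ∀ η : ℝ, 0 < η → ∃ δ : ℝ, 0 < δ ∧
      ∀ n, AldousBound hT P 𝓕 (X n) (ENNReal.ofReal ε) η δ)
    (hbound : (⨆ n, ∫⁻ ω, (⨆ t, A.energyENorm (X n t ω) ^ 2) ∂P) < ∞)
    (hL : ∀ R : ℝ, ∃ L : Set A.DualEnergySpace, IsCompact L ∧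
      ∀ y, A.energyENorm y ≤ ENNReal.ofReal R → y ∈ L)
    {W : ι → Ω → CadlagPath T A.DualEnergySpace}
    (hW : ∀ n, ∀ᵐ ω ∂P, ∀ t, (W n ω).toFun t = X n t ω) {ε : ℝ≥0∞} (hε : 0 < ε) :
    ∃ R : ℝ, 0 ≤ R ∧ ∃ 𝒦 : Set (CadlagPath T A.DualEnergySpace), IsCompact (closure 𝒦) ∧
      (∀ v ∈ 𝒦, ∀ t, A.energyENorm (v.toFun t) ≤ ENNReal.ofReal R) ∧
      ∀ n, P {ω | W n ω ∉ 𝒦} ≤ ε := by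
  set C := ⨆ n, ∫⁻ ω, (⨆ t, A.energyENorm (X n t ω) ^ 2) ∂P
  have hε2 : ε / 2 ≠ 0 := (ENNReal.half_pos hε.ne').ne'
  -- the energy bound, by Markov's inequality
  obtain ⟨R, hR1, hR⟩ : ∃ R : ℝ, 1 ≤ R ∧ C / ENNReal.ofReal R ^ 2 ≤ ε / 2 := by
    have h₀ : Tendsto (fun R : ℝ => C / ENNReal.ofReal R ^ 2) atTop (𝓝 0) := by
      have h₁ : Tendsto (fun R : ℝ => ENNReal.ofReal R ^ 2) atTop (𝓝 ∞) := by
        have := (ENNReal.continuous_pow 2).tendsto ∞ |>.comp ENNReal.tendsto_ofReal_atTop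
        simpa [Function.comp_def] using this
      simpa using ENNReal.Tendsto.const_div h₁ (Or.inr hbound.ne)
    exact ((eventually_ge_atTop 1).and
      (h₀.eventually_le_const (pos_iff_ne_zero.2 hε2))).exists
  have hR0 : 0 ≤ R := zero_le_one.trans hR1
  have henergy : ∀ n,
      P {ω | ¬ ∀ t, A.energyENorm ((W n ω).toFun t) ≤ ENNReal.ofReal R} ≤ ε / 2 := by
    intro n
    have hmeas : AEMeasurable (fun ω => ⨆ t, A.energyENorm (X n t ω) ^ 2) P := by
      refine aemeasurable_iSup_energyENorm_sq A hT (fun t => (hX n t).mono (𝓕.le t)) ?_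
      filter_upwards [hW n] with ω hω
      rw [← show (W n ω).toFun = fun t => X n t ω from funext hω]
      exact (W n ω).isCadlag
    have hRpow0 : ENNReal.ofReal R ^ 2 ≠ 0 :=
      pow_ne_zero 2 (ENNReal.ofReal_pos.2 (zero_lt_one.trans_le hR1)).ne'
    refine le_trans (measure_mono_ae ?_) ((meas_ge_le_lintegral_div hmeas hRpow0
      (ENNReal.pow_ne_top ENNReal.ofReal_ne_top)).trans ((ENNReal.div_le_div_right
        (le_iSup (fun n => ∫⁻ ω, (⨆ t, A.energyENorm (X n t ω) ^ 2) ∂P) n) _).trans hR))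
    filter_upwards [hW n] with ω hω (hlt : ¬ ∀ t, A.energyENorm ((W n ω).toFun t) ≤ _)
    obtain ⟨t, ht⟩ := not_forall.1 hlt
    rw [hω, not_le] at ht
    exact (pow_le_pow_left' ht.le 2).trans (le_iSup (fun t => A.energyENorm (X n t ω) ^ 2) t)
  -- the approximation by discretized paths
  obtain ⟨ε', hε'0, hε'⟩ := ENNReal.exists_pos_sum_of_countable hε2 ℕ
  choose N hN using fun k : ℕ => exists_measure_lt_edist_discretize_le (P := P) hT hX hA hW
    (show (0 : ℝ) < ε' k from hε'0 k) (Nat.one_div_pos_of_nat (α := ℝ) (n := k))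
  obtain ⟨L, hLc, hL⟩ := hL R
  refine ⟨R, hR0, {v | (∀ t, A.energyENorm (v.toFun t) ≤ ENNReal.ofReal R) ∧
    ∀ k : ℕ, edist v (discretize hT (N k) v.toFun) ≤ ENNReal.ofReal (1 / (k + 1))}, ?_,
    fun v hv => hv.1, fun n => ?_⟩
  · exact isCompact_closure_of_discretize hT hLc (fun v hv t => hL _ (hv.1 t)) N
      fun v hv k => hv.2 k
  · have hsub : {ω | W n ω ∉ {v | (∀ t, A.energyENorm (v.toFun t) ≤ ENNReal.ofReal R) ∧
        ∀ k : ℕ, edist v (discretize hT (N k) v.toFun) ≤ ENNReal.ofReal (1 / (k + 1))}}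
        ⊆ {ω | ¬ ∀ t, A.energyENorm ((W n ω).toFun t) ≤ ENNReal.ofReal R} ∪ ⋃ k : ℕ,
          {ω | ENNReal.ofReal (1 / (k + 1))
            < edist (W n ω) (discretize hT (N k) (W n ω).toFun)} := by
      intro ω hω
      simp only [mem_ofPred_eq, not_and_or, not_forall, not_le] at hω
      rcases hω with ⟨t, ht⟩ | ⟨k, hk⟩
      · exact Or.inl fun h => (h t).not_gt ht
      · exact Or.inr (mem_iUnion.2 ⟨k, hk⟩)
    refine (measure_mono hsub).trans ((measure_union_le _ _).trans ?_)
    rw [← ENNReal.add_halves ε]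
    refine add_le_add (henergy n) ((measure_iUnion_le _).trans (le_trans ?_ hε'.le))
    refine ENNReal.tsum_le_tsum fun k => (hN k n).trans (le_of_eq ?_)
    exact ENNReal.ofReal_coe_nnreal

end Tightness

theorem proposition4p8
    -- the measure space `M` of finite measure, the operator `A` on `H = L²(M)`, and `α`
    {M : Type*} [MeasurableSpace M] (μ : Measure M) [IsFiniteMeasure μ]
    (A : NonnegSelfAdjointOp (Lp ℂ 2 μ)) (α : ℝ) [Fact (1 < α)]
    (hp : A.EnergySubsetLp (ENNReal.ofReal (α + 1))) (hcompact : IsCompactOperator hp.incl)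
    -- the filtered probability space
    (T : ℝ) (hT : 0 < T)
    {Ω : Type*} {mΩ : MeasurableSpace Ω} (P : Measure Ω) [IsProbabilityMeasure P]
    (𝓕 : Filtration (Icc (0 : ℝ) T) mΩ) (h𝓕 : UsualConditions P 𝓕)
    -- the processes
    (X : ℕ → Icc (0 : ℝ) T → Ω → A.DualEnergySpace)
    (hadapted : ∀ n, StronglyAdapted 𝓕 (X n))
    (hcadlag : ∀ n, ∀ᵐ ω ∂P, IsCadlag fun t => X n t ω)
    (hAldous : AldousCondition hT.le P 𝓕 X)
    (hbound : (⨆ n, ∫⁻ ω, (⨆ t, A.energyENorm (X n t ω) ^ 2) ∂P) < ∞) :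
    -- almost all paths of `X n` lie in `Z_T`, the resulting `Z_T`-valued random variables
    -- (unique up to null sets) are measurable, and their laws form a tight set of measures
    ∃ Y : ℕ → Ω → EnergyPath A hp T,
      (∀ n, Measurable (Y n)) ∧
      (∀ n, ∀ᵐ ω ∂P, ∀ t, A.energyToDual ((Y n ω).toFun t) = X n t ω) ∧
      IsTightMeasureSet (Set.range fun n => P.map (Y n)) := by
  have hα : 1 < α := Fact.out
  have hp2 : 2 ≤ ENNReal.ofReal (α + 1) := by
    rw [show (2 : ℝ≥0∞) = ENNReal.ofReal 2 by simp]
    exact ENNReal.ofReal_le_ofReal (by linarith)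
  have hp_top : ENNReal.ofReal (α + 1) ≠ ∞ := ENNReal.ofReal_ne_top
  have hmeas : ∀ n t, StronglyMeasurable (X n t) := fun n t => (hadapted n t).mono (𝓕.le t)
  -- the paths that are càdlàg with bounded energy; the others are replaced by the zero path
  let Good : ℕ → Set Ω := fun n =>
    {ω | (IsCadlag fun t => X n t ω) ∧ ⨆ t, A.energyENorm (X n t ω) ^ 2 < ∞}
  have hGood : ∀ n, ∀ᵐ ω ∂P, ω ∈ Good n := fun n => by
    have hfin : ∫⁻ ω, (⨆ t, A.energyENorm (X n t ω) ^ 2) ∂P ≠ ∞ :=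
      ((le_iSup (fun n => ∫⁻ ω, (⨆ t, A.energyENorm (X n t ω) ^ 2) ∂P) n).trans_lt hbound).ne
    filter_upwards [hcadlag n, ae_lt_top' (aemeasurable_iSup_energyENorm_sq A hT (hmeas n)
      (hcadlag n)) hfin] with ω h₁ h₂
    exact ⟨h₁, h₂⟩
  have hGoodm : ∀ n, MeasurableSet (Good n) := fun n =>
    (h𝓕.complete.out' _ (hGood n)).of_compl
  have hY : ∀ n ω, ∃ u : EnergyPath A hp T, (∃ R : ℝ, ∀ t, ‖u.toFun t‖ ≤ R) ∧
      ∀ t, A.energyToDual (u.toFun t) = (Good n).indicator (X n t) ω := by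
    intro n ω
    by_cases hω : ω ∈ Good n
    · simp only [indicator_of_mem hω]
      set c := ⨆ t, A.energyENorm (X n t ω) ^ 2
      obtain ⟨u, hu⟩ := EnergyPath.exists_of_bounded (hp := hp) hT hp2 hcompact hω.1
        (R := (c + 1).toReal) ENNReal.toReal_nonneg fun t => by
          rw [ENNReal.ofReal_toReal (ENNReal.add_ne_top.2 ⟨hω.2.ne, ENNReal.one_ne_top⟩)]
          have hle : A.energyENorm (X n t ω) ^ 2 ≤ c :=
            le_iSup (fun t => A.energyENorm (X n t ω) ^ 2) t
          rcases le_total (A.energyENorm (X n t ω)) 1 with h | h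
          · exact h.trans le_add_self
          · exact (le_self_pow₀ h two_ne_zero).trans (hle.trans le_self_add)
      exact ⟨u, ⟨_, hu.1⟩, hu.2⟩
    · simp only [indicator_of_notMem hω]
      obtain ⟨u, hu⟩ := EnergyPath.exists_of_bounded (hp := hp) hT hp2 hcompact
        (v := fun _ => 0) (isCadlag_const 0) le_rfl fun t =>
          (A.energyENorm_le_iff le_rfl).2 ⟨0, by simp, map_zero _⟩
      exact ⟨u, ⟨_, hu.1⟩, hu.2⟩
  choose Y hYbdd hYX using hY
  have hYae : ∀ n, ∀ᵐ ω ∂P, ∀ t, A.energyToDual ((Y n ω).toFun t) = X n t ω := fun n => by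
    filter_upwards [hGood n] with ω hω t
    rw [hYX, indicator_of_mem hω]
  have hYm : ∀ n, Measurable (Y n) := fun n => by
    refine EnergyPath.measurable_of_toCadlag hp2 hp_top hcompact (hYbdd n)
      (stronglyMeasurable_cadlagPath hT fun t => ?_)
    change StronglyMeasurable fun ω => A.energyToDual ((Y n ω).toFun t)
    simp only [hYX]
    exact (hmeas n t).indicator (hGoodm n)
  refine ⟨Y, hYm, hYae, isTightMeasureSet_iff_exists_isCompact_measure_compl_le.2 fun ε hε => ?_⟩
  have hA : ∀ ε : ℝ, 0 < ε → ∀ η : ℝ, 0 < η → ∃ δ : ℝ, 0 < δ ∧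
      ∀ n, AldousBound hT P 𝓕 (X n) (ENNReal.ofReal ε) η δ := fun ε hε η hη => by
    obtain ⟨δ, hδ, h⟩ := hAldous ε hε η hη
    exact ⟨δ, hδ, fun n τ hτ θ hθ hθδ => h (fun _ => τ) (fun _ => hτ) n θ hθ hθδ⟩
  have hL : ∀ R : ℝ, ∃ L : Set A.DualEnergySpace, IsCompact L ∧
      ∀ y, A.energyENorm y ≤ ENNReal.ofReal R → y ∈ L := fun R => by
    refine ⟨_, (hcompact.isCompact_closure_image_closedBall (max R 0)).image
      (A.lpToDual hp2).continuous, fun y hy => ?_⟩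
    obtain ⟨x, hx, rfl⟩ := (A.energyENorm_le_iff (le_max_right R 0)).1
      (hy.trans (ENNReal.ofReal_le_ofReal (le_max_left R 0)))
    exact ⟨hp.incl x, subset_closure ⟨x, by simpa using hx, rfl⟩,
      NonnegSelfAdjointOp.lpToDual_incl hp2 hp x⟩
  obtain ⟨R, hR, 𝒦, h𝒦, hbdd, hP⟩ := exists_compact_of_aldous A hT hadapted hA hbound hL
    (W := fun n ω => (Y n ω).toCadlag) hYae hε
  have hbdd' : ∀ v ∈ closure 𝒦, ∀ t, A.energyENorm (v.toFun t) ≤ ENNReal.ofReal R :=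
    closure_minimal hbdd (EnergyPath.isClosed_energyENorm_le A T _)
  refine ⟨EnergyPath.toCadlag ⁻¹' closure 𝒦,
    EnergyPath.isCompact_preimage_toCadlag hT hp2 hp_top hcompact hR h𝒦 hbdd', ?_⟩
  rintro _ ⟨n, rfl⟩
  have : BorelSpace (EnergyPath A hp T) := ⟨rfl⟩
  have hclosed : IsClosed (EnergyPath.toCadlag ⁻¹' closure 𝒦 : Set (EnergyPath A hp T)) :=
    isClosed_closure.preimage EnergyPath.continuous_toCadlag
  rw [Measure.map_apply (hYm n) hclosed.measurableSet.compl]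
  refine (measure_mono ?_).trans (hP n)
  exact fun ω (hω : ¬ (Y n ω).toCadlag ∈ closure 𝒦) h => hω (subset_closure h)
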